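/- Let $V$ be an $n$-dimensional vector space over the finite field $\mathbb{F}_q$, and let $\mathcal{P}$ be a finite classical polar space in $V$. That is, $\mathcal{P}$ consists of the totally isotropic (respectively totally singular) subspaces of $V$ with respect to a non-degenerate alternating or Hermitian form (respectively quadratic form) on $V$; a quadratic form is non-degenerate if the radical of its polar form contains no nonzero singular vector, and for a Hermitian form $q$ is a square. The rank $r$ of $\mathcal{P}$ is the maximal vector space dimension of its elements, the elements of dimension $r$ are its generators, and a partial $m$-ovoid of $\mathcal{P}$ is a set of points (one-dimensional elements) of $\mathcal{P}$ that meets every generator in at most $m$ points; a partial ovoid is a partial $1$-ovoid. The type of $\mathcal{P}$ is symplectic, Hermitian, elliptic (quadric, $n$ even, $r=(n-2)/2$), parabolic (quadric, $n$ odd), or hyperbolic (quadric, $n$ even, $r=n/2$). Suppose $r\ge 3$ and let $\mathcal{O}_2$ be a partial $2$-ovoid of $\mathcal{P}$. Then \[ |\mathcal{O}_2| \le q\cdot b(n-2,q)+\sigma_r , \] where $b(n',q)$ is the maximal size of a partial ovoid in a polar space of the same type as $\mathcal{P}$ in an $n'$-dimensional vector space over $\mathbb{F}_q$, and $\sigma_r$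 is the ovoid number of $\mathcal{P}$: $\sigma_r=q^{n/2}+1$ in the symplectic and elliptic cases, $q^{(n-1)/2}+1$ in the parabolic case, $q^{n/2-1}+1$ in the hyperbolic case, and, in the Hermitian case, $\sqrt{q}^{\,n}+1$ for $n$ odd and $\sqrt{q}^{\,n-1}+1$ for $n$ even. -/

import Mathlib

open Module
open scoped LinearAlgebra.Projectivization

/-- The non-degenerate forms defining the finite classical polar spaces. -/
inductive PolarForm (K V : Type*) [Field K] [AddCommGroup V] [Module K V]
  /-- A non-degenerate alternating bilinear form. -/
  | alternating (B : V →ₗ[K] V →ₗ[K] K) (isAlt : B.IsAlt) (nondeg : B.Nondegenerate)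
  /-- A non-degenerate Hermitian form, with respect to a field automorphism of order two. -/
  | hermitian (τ : K →+* K) (invol : ∀ a, τ (τ a) = a) (ne_id : τ ≠ RingHom.id K)
      (B : V →ₛₗ[τ] V →ₗ[K] K) (isSymm : B.IsSymm) (nondeg : B.Nondegenerate)
  /-- A non-degenerate quadratic form: the radical of its polar form contains no nonzero
  singular vector. In characteristic two that radical itself may be nonzero. -/
  | quadratic (Q : QuadraticForm K V)
      (nondeg : ∀ v, Q v = 0 → (∀ w, QuadraticMap.polar Q v w = 0) → v = 0)

/-- The types of finite classical polar spaces. -/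
inductive PolarType
  | symplectic
  | hermitian
  | elliptic
  | parabolic
  | hyperbolic

namespace PolarForm

variable {K V : Type*} [Field K] [AddCommGroup V] [Module K V]

/-- Totally isotropic (sesquilinear case) or totally singular (quadratic case) subspaces:
the elements of the polar space. -/
def IsTotallySingular (f : PolarForm K V) (W : Submodule K V) : Prop :=
  match f with
  | alternating B _ _ => ∀ x ∈ W, ∀ y ∈ W, B x y = 0
  | hermitian _ _ _ B _ _ => ∀ x ∈ W, ∀ y ∈ W, B x y = 0
  | quadratic Q _ => ∀ x ∈ W, Q x = 0

/-- The rank of the polar space, i.e. the Witt index of the form: the largest vector space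
dimension of a totally singular subspace. -/
noncomputable def rank (f : PolarForm K V) : ℕ :=
  sSup {d : ℕ | ∃ W : Submodule K V, f.IsTotallySingular W ∧ finrank K W = d}

/-- Generators: totally singular subspaces of maximal dimension. -/
def IsGenerator (f : PolarForm K V) (W : Submodule K V) : Prop :=
  f.IsTotallySingular W ∧ finrank K W = f.rank

/-- A partial `m`-ovoid: a set of points of the polar space meeting every generator in at
most `m` points. -/
def IsPartialOvoid (f : PolarForm K V) (m : ℕ) (O : Set (ℙ K V)) : Prop :=
  (∀ P ∈ O, f.IsTotallySingular P.submodule) ∧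
    ∀ W : Submodule K V, f.IsGenerator W → {P ∈ O | P.submodule ≤ W}.encard ≤ m

open Classical in
/-- The type of the polar space. A quadric is parabolic in odd vector space dimension `n`; for
even `n` it is hyperbolic if its rank is `n / 2` and elliptic otherwise. -/
noncomputable def type (f : PolarForm K V) : PolarType :=
  match f with
  | alternating _ _ _ => .symplectic
  | hermitian _ _ _ _ _ _ => .hermitian
  | quadratic Q h =>
      if Odd (finrank K V) then .parabolic
      else if 2 * (quadratic Q h).rank = finrank K V then .hyperbolic
      else .elliptic

end PolarForm

/-- The ovoid number of a polar space of type `t` in an `n`-dimensional vector space over the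
field with `q` elements. In the Hermitian case `q` is the square of an integer. -/
def ovoidNumber (t : PolarType) (n q : ℕ) : ℕ :=
  match t with
  | .symplectic => q ^ (n / 2) + 1
  | .hermitian => if Odd n then Nat.sqrt q ^ n + 1 else Nat.sqrt q ^ (n - 1) + 1
  | .elliptic => q ^ (n / 2) + 1
  | .parabolic => q ^ ((n - 1) / 2) + 1
  | .hyperbolic => q ^ (n / 2 - 1) + 1

/-- The maximal size of a partial ovoid in a polar space of type `t` in the `n`-dimensional
vector space over `K`. -/
noncomputable def maxPartialOvoid (K : Type*) [Field K] (t : PolarType) (n : ℕ) : ℕ :=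
  sSup {s : ℕ | ∃ f : PolarForm K (Fin n → K), f.type = t ∧
    ∃ O : Set (ℙ K (Fin n → K)), f.IsPartialOvoid 1 O ∧ O.ncard = s}

/-! The bound combines a local estimate with a spectral one. Locally, a point E of a partial 2-ovoid
is orthogonal to at most d = b(n-2,q) other points of it: projecting these from E into the residue
E^⊥/E, a polar space of the same type in dimension n-2, gives a partial ovoid, because a residual
generator lifts to a generator through E, which contains at most one further point of the set
(`IsPartialOvoid.ncard_perp_le`).

Globally, fix a nontrivial additive character ψ and consider the kernel ψ(B(x,y)) on singular
vectors. On functions constant along punctured lines it satisfies a quadratic equation (M - a)(M +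
b) = 0, so M + b is positive semidefinite, and b is at most σ - 1 (`PolarForm.energy_nonneg`). For
alternating forms M² = |V|. For quadratic forms the equation comes from Gauss sums, with a = |W| and
b = |W^⊥|/q for a generator W. A Hermitian form becomes a quadratic form over the fixed field of its
involution.

Testing positivity on a weighted indicator of the vectors of a point set of size s, each point
orthogonal to at most d others, gives 0 ≤ (q-1)(σ-s) + s(qd+σ-s), which is impossible for s > qd + σ
(`PolarForm.ncard_le_of_perp_le`). -/

open Finset in
/-- If `û(x) = ∑ y, u y * M x y` is real on `C` and `u` satisfies the quadratic equation
`(M - a) (M + b) u = 0` on `C`, then `u` has nonnegative energy with respect to `M + b`. -/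
theorem sum_mul_add_nonneg {V : Type*} [Fintype V] (C : Finset V) (M : V → V → ℂ) (u v : V → ℝ)
    (a b : ℝ) (ha : 0 < a) (hb : 0 < b) (hu : ∀ x ∉ C, u x = 0)
    (hv : ∀ x ∈ C, (v x : ℂ) = ∑ y, u y * M x y)
    (hM : ∀ y ∈ C, ∑ x ∈ C, M x y * v x = (a - b) * v y + a * b * u y) :
    0 ≤ ∑ x, u x * v x + b * ∑ x, u x ^ 2 := by
  have hres (g : V → ℝ) : ∑ x, u x * g x = ∑ x ∈ C, u x * g x := by
    refine (Finset.sum_subset (subset_univ C) fun x _ hx => ?_).symm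
    rw [hu x hx, zero_mul]
  have h1 : ∑ x ∈ C, v x ^ 2 = (a - b) * ∑ x, u x * v x + a * b * ∑ x, u x ^ 2 := by
    have : ((∑ x ∈ C, v x ^ 2 : ℝ) : ℂ) =
        (((a - b) * ∑ x, u x * v x + a * b * ∑ x, u x ^ 2 : ℝ) : ℂ) := by
      simp_rw [pow_two, hres]
      push_cast
      calc ∑ x ∈ C, (v x : ℂ) * v x = ∑ x ∈ C, ∑ y, (u y : ℂ) * (M x y * v x) := by
            refine Finset.sum_congr rfl fun x hx => ?_
            nth_rewrite 1 [hv x hx]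
            rw [Finset.sum_mul]
            exact Finset.sum_congr rfl fun y _ => by ring
        _ = ∑ y, (u y : ℂ) * ∑ x ∈ C, M x y * v x := by
            rw [Finset.sum_comm]
            simp_rw [Finset.mul_sum]
        _ = ∑ y ∈ C, (u y : ℂ) * ∑ x ∈ C, M x y * v x := by
            refine (Finset.sum_subset (subset_univ C) fun x _ hx => ?_).symm
            rw [hu x hx, Complex.ofReal_zero, zero_mul]
        _ = _ := by
            rw [Finset.mul_sum, Finset.mul_sum, ← Finset.sum_add_distrib]
            refine Finset.sum_congr rfl fun y hy => ?_
            rw [hM y hy]; ring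
    exact_mod_cast this
  -- The quadratic equation turns (M + b)² into (a + b)(M + b), so the energy is a positive multiple
  -- of a sum of squares.
  have h2 : ∑ x ∈ C, (v x + b * u x) ^ 2
      = (a + b) * (∑ x, u x * v x + b * ∑ x, u x ^ 2) := by
    have : ∑ x ∈ C, (v x + b * u x) ^ 2
        = ∑ x ∈ C, v x ^ 2 + 2 * b * ∑ x, u x * v x + b ^ 2 * ∑ x, u x ^ 2 := by
      simp_rw [fun x => pow_two (u x), hres, Finset.mul_sum, ← Finset.sum_add_distrib]
      exact Finset.sum_congr rfl fun x _ => by ring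
    rw [this, h1]; ring
  have h3 : 0 ≤ (a + b) * (∑ x, u x * v x + b * ∑ x, u x ^ 2) :=
    h2 ▸ Finset.sum_nonneg fun x _ => sq_nonneg _
  exact nonneg_of_mul_nonneg_right h3 (by positivity)

/-! ### Character sums and scale-invariant functions -/

section CharacterSums

variable {k V : Type*} [Field k] [AddCommGroup V] [Module k V]

open Classical in
theorem sum_addChar_linear [Fintype V] {ψ : AddChar k ℂ} (hψ : ψ ≠ 1) (l : V →ₗ[k] k) :
    ∑ v, ψ (l v) = if l = 0 then (Fintype.card V : ℂ) else 0 := by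
  have h := AddChar.sum_eq_ite (ψ.compAddMonoidHom l.toAddMonoidHom)
  have key : (ψ.compAddMonoidHom l.toAddMonoidHom = 0) ↔ l = 0 := by
    constructor
    · intro h0
      by_contra hl
      obtain ⟨v, hv⟩ := DFunLike.ne_iff.mp hl
      refine hψ ?_
      ext a
      have := DFunLike.congr_fun h0 ((a / l v) • v)
      simpa [div_mul_cancel₀ _ (show l v ≠ 0 by simpa using hv)] using this
    · rintro rfl
      ext a
      simp
  simp only [key] at h
  exact h

open Classical in
theorem sum_addChar_mul [Fintype k] {ψ : AddChar k ℂ} (hψ : ψ ≠ 1) (b : k) :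
    ∑ t, ψ (t * b) = if b = 0 then (Fintype.card k : ℂ) else 0 := by
  have h := sum_addChar_linear hψ (LinearMap.toSpanSingleton k k b)
  simpa [LinearMap.toSpanSingleton_eq_zero_iff] using h

/-- Functions on `V` that are constant on the nonzero vectors of each line. -/
def IsScaleInvariant (k : Type*) {V : Type*} [Field k] [AddCommGroup V] [Module k V]
    {α : Type*} (u : V → α) : Prop :=
  ∀ (c : k) (x : V), c ≠ 0 → u (c • x) = u x

theorem IsScaleInvariant.neg {α : Type*} {u : V → α} (hu : IsScaleInvariant k u) (x : V) :
    u (-x) = u x := by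
  have := hu (-1) x (by simp)
  simpa using this

/-- Rescaling the argument of a character does not change the transform of `u`; this later removes
the factors -t⁻¹ produced by completing the square. -/
theorem IsScaleInvariant.sum_smul [Fintype V] {u : V → ℝ} (hu : IsScaleInvariant k u)
    (g : V → ℂ) {c : k} (hc : c ≠ 0) : ∑ z, u z * g (c • z) = ∑ z, u z * g z := by
  refine Fintype.sum_equiv (LinearEquiv.smulOfNeZero k V c hc).toEquiv _ _ fun z => ?_
  simp [hu c z hc]

theorem AddChar.conj_apply_of_finite [Finite k] (ψ : AddChar k ℂ) (b : k) :
    (starRingEnd ℂ) (ψ b) = ψ (-b) := by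
  rw [AddChar.map_neg_eq_inv, ← Complex.inv_eq_conj (AddChar.norm_apply ψ b)]

/-- The transform of a scale-invariant function by a family of linear functionals is real. -/
theorem IsScaleInvariant.ofReal_re_sum [Finite k] [Fintype V] {u : V → ℝ}
    (hu : IsScaleInvariant k u) (ψ : AddChar k ℂ) (l : V →ₗ[k] k) :
    (((∑ y, u y * ψ (l y)).re : ℝ) : ℂ) = ∑ y, u y * ψ (l y) := by
  rw [← Complex.conj_eq_iff_re, map_sum]
  simp_rw [map_mul, Complex.conj_ofReal, AddChar.conj_apply_of_finite]
  rw [← hu.sum_smul (fun z => ψ (l z)) (neg_ne_zero.mpr one_ne_zero)]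
  simp

end CharacterSums

/-! ### Spectral bound for bilinear forms -/

section Alternating

variable {k V : Type*} [Field k] [Finite k] [AddCommGroup V] [Module k V] [Fintype V]

/-- Character orthogonality sends `u` under two transforms to |V| u(-y), and `u` is even, so the
quadratic equation holds with both parameters equal to √|V|. -/
theorem alternating_energy_nonneg {ψ : AddChar k ℂ} (hψ : ψ ≠ 1) (B : V →ₗ[k] V →ₗ[k] k)
    (hB : B.Nondegenerate) (b : ℝ) (hb : 0 < b)
    (hbV : b ^ 2 = Fintype.card V) (u : V → ℝ) (hu : IsScaleInvariant k u) :
    0 ≤ ∑ x, u x * (∑ y, u y * ψ (B x y)).re + b * ∑ x, u x ^ 2 := by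
  classical
  refine sum_mul_add_nonneg Finset.univ (fun x y => ψ (B x y)) u
    (fun x => (∑ y, u y * ψ (B x y)).re) b b hb hb (by simp)
    (fun x _ => hu.ofReal_re_sum ψ (B x)) fun y _ => ?_
  simp_rw [fun x => hu.ofReal_re_sum ψ (B x), Finset.mul_sum]
  rw [Finset.sum_comm]
  have h (z : V) : ∑ x, ψ (B x y) * (u z * ψ (B x z))
      = if z = -y then (u y : ℂ) * (Fintype.card V : ℂ) else 0 := by
    have h1 := sum_addChar_linear hψ (B.flip (y + z))
    have h2 : B.flip (y + z) = 0 ↔ z = -y := by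
      constructor
      · intro h
        have := hB.2 (y + z) fun x => by simpa using DFunLike.congr_fun h x
        exact (neg_eq_of_add_eq_zero_right this).symm
      · rintro rfl
        simp
    simp only [h2] at h1
    calc ∑ x, ψ (B x y) * (u z * ψ (B x z)) = u z * ∑ x, ψ (B.flip (y + z) x) := by
          rw [Finset.mul_sum]
          refine Finset.sum_congr rfl fun x _ => ?_
          rw [LinearMap.flip_apply, map_add, AddChar.map_add_eq_mul]
          ring
      _ = _ := by
          rw [h1]
          split_ifs with hz
          · rw [hz, hu.neg]
          · simp
  simp_rw [h]
  have : ((b ^ 2 : ℝ) : ℂ) = (Fintype.card V : ℂ) := by rw [hbV]; simp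
  push_cast at this
  simp only [Finset.sum_ite_eq', Finset.mem_univ, if_true, ← this, sub_self, zero_mul,
    Finset.sum_const_zero, zero_add]
  ring

end Alternating

/-! ### Gauss sums and the spectral bound for quadratic forms -/

section Quadratic

variable {k V : Type*} [Field k] [AddCommGroup V] [Module k V] (Q : QuadraticForm k V)

open QuadraticMap

/-- The vectors orthogonal to a subspace with respect to the polar form. -/
def polarOrth (W : Submodule k V) : Submodule k V where
  carrier := {v | ∀ w ∈ W, polar Q v w = 0}
  add_mem' := fun {a b} ha hb w hw => by rw [polar_add_left, ha w hw, hb w hw, add_zero]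
  zero_mem' := fun w _ => polar_zero_left _ w
  smul_mem' := fun c x hx w hw => by rw [polar_smul_left, hx w hw, smul_zero]

theorem mem_polarOrth {W : Submodule k V} {v : V} :
    v ∈ polarOrth Q W ↔ ∀ w ∈ W, polar Q v w = 0 := Iff.rfl

variable [Fintype V] {ψ : AddChar k ℂ}

open Classical in
theorem sum_addChar_polar (hψ : ψ ≠ 1) (W : Submodule k V) (c : k) (hc : c ≠ 0) (v : V) :
    ∑ w : W, ψ (c * polar Q v w)
      = if v ∈ polarOrth Q W then (Fintype.card W : ℂ) else 0 := by
  have h := sum_addChar_linear hψ (c • (polarBilin Q v).domRestrict W)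
  have h2 : c • (polarBilin Q v).domRestrict W = 0 ↔ v ∈ polarOrth Q W := by
    rw [smul_eq_zero_iff_right hc, mem_polarOrth]
    constructor
    · intro h w hw
      exact DFunLike.congr_fun h ⟨w, hw⟩
    · intro h
      ext w
      exact h w w.2
  simp only [h2] at h
  simpa using h

-- Evaluate the sum of ψ(polar Q v w) over V × W in both orders. Only singular vectors of `W` have
-- to avoid the radical, so a nonzero radical in characteristic two is harmless.
open Classical in
theorem card_mul_card_polarOrth (hψ : ψ ≠ 1)
    (hQ : ∀ v, Q v = 0 → (∀ w, polar Q v w = 0) → v = 0)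
    (W : Submodule k V) (hW : ∀ w ∈ W, Q w = 0) :
    Fintype.card W * Fintype.card (polarOrth Q W) = Fintype.card V := by
  have h1 : ∑ v : V, ∑ w : W, ψ (1 * polar Q v w)
      = (Fintype.card W * Fintype.card (polarOrth Q W) : ℂ) := by
    simp_rw [sum_addChar_polar Q hψ W 1 one_ne_zero, Finset.sum_ite, Finset.sum_const_zero,
      add_zero, Finset.sum_const, nsmul_eq_mul]
    rw [mul_comm, Fintype.card_subtype (· ∈ polarOrth Q W)]
  have h2 : ∑ v : V, ∑ w : W, ψ (1 * polar Q v w) = (Fintype.card V : ℂ) := by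
    rw [Finset.sum_comm]
    have (w : W) : ∑ v : V, ψ (1 * polar Q v w)
        = if w = 0 then (Fintype.card V : ℂ) else 0 := by
      have h := sum_addChar_linear hψ (polarBilin Q w)
      have h3 : polarBilin Q w = 0 ↔ w = 0 := by
        constructor
        · intro h
          exact Subtype.ext (hQ w (hW w w.2) fun v => DFunLike.congr_fun h v)
        · rintro rfl
          simp
      simp only [h3] at h
      rw [← h]
      refine Finset.sum_congr rfl fun v _ => ?_
      rw [one_mul, polar_comm]
      rfl
    simp_rw [this, Finset.sum_ite_eq', Finset.mem_univ, if_true]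
  exact_mod_cast h1.symm.trans h2

open Classical in
/-- The Gauss sum of a quadratic form is supported on the orthogonal complement of any totally
singular subspace. -/
theorem sum_addChar_quadratic (hψ : ψ ≠ 1) (W : Submodule k V) (hW : ∀ w ∈ W, Q w = 0)
    (t : k) (ht : t ≠ 0) :
    ∑ v, ψ (t * Q v) = ∑ v : polarOrth Q W, ψ (t * Q v) := by
  have h1 : (Fintype.card W : ℂ) * ∑ v, ψ (t * Q v)
      = ∑ v, ψ (t * Q v) * ∑ w : W, ψ (t * polar Q v w) := by
    -- Translate the summation variable by w. Averaging over `W` then kills every v outside the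
    -- orthogonal complement.
    have (w : W) : ∑ v, ψ (t * Q v) = ∑ v, ψ (t * Q v) * ψ (t * polar Q v w) := by
      rw [← Equiv.sum_comp (Equiv.addRight (w : V)) fun v => ψ (t * Q v)]
      refine Finset.sum_congr rfl fun v _ => ?_
      rw [← AddChar.map_add_eq_mul, ← mul_add, Equiv.coe_addRight, QuadraticMap.map_add Q v w,
        hW w w.2, add_zero]
    simp_rw [Finset.mul_sum Finset.univ (fun w : W => _)]
    rw [Finset.sum_comm, ← Finset.sum_congr rfl fun w _ => this w, Finset.sum_const, nsmul_eq_mul]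
    rfl
  have h2 : (Fintype.card W : ℂ) ≠ 0 := by simp
  refine mul_left_cancel₀ h2 ?_
  rw [h1]
  simp_rw [sum_addChar_polar Q hψ W t ht, mul_ite, mul_zero]
  rw [← Finset.sum_filter, ← Finset.sum_mul, mul_comm,
    Finset.sum_subtype (p := (· ∈ polarOrth Q W)) _ (by simp)]

-- Only v in W^⊥ contribute, and there Q vanishes exactly on `W`; summing over nonzero t gives q - 1
-- for v in `W` and -1 for the rest.
open Classical in
theorem sum_sum_addChar_quadratic [Fintype k] (hψ : ψ ≠ 1) (W : Submodule k V)
    (hW : ∀ w ∈ W, Q w = 0)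
    (hmax : ∀ v ∈ polarOrth Q W, Q v = 0 → v ∈ W) :
    ∑ t ∈ Finset.univ.erase (0 : k), ∑ v, ψ (t * Q v)
      = Fintype.card k * Fintype.card W - Fintype.card (polarOrth Q W) := by
  have hWo : W ≤ polarOrth Q W := fun v hv w hw => by
    simp [polar, hW _ (W.add_mem hv hw), hW v hv, hW w hw]
  rw [Finset.sum_congr rfl fun t ht =>
    sum_addChar_quadratic Q hψ W hW t (Finset.ne_of_mem_erase ht), Finset.sum_comm]
  have h (v : polarOrth Q W) : ∑ t ∈ Finset.univ.erase (0 : k), ψ (t * Q v)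
      = (if (v : V) ∈ W then (Fintype.card k : ℂ) else 0) - 1 := by
    have h1 := sum_addChar_mul hψ (Q v)
    rw [← Finset.add_sum_erase _ _ (Finset.mem_univ 0)] at h1
    have h2 : Q v = 0 ↔ (v : V) ∈ W := ⟨hmax v v.2, hW v⟩
    simp only [h2, zero_mul, AddChar.map_zero_eq_one] at h1
    rw [← h1]; ring
  simp_rw [h]
  rw [Finset.sum_sub_distrib]
  congr 1
  · rw [← Finset.sum_filter, Finset.sum_const, nsmul_eq_mul, mul_comm]
    congr 2
    rw [← Fintype.card_subtype]
    exact Fintype.card_congr (Equiv.subtypeSubtypeEquivSubtype fun h => hWo h)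
  · simp

-- The quadratic equation holds on the singular cone with a = |W| and b = |W^⊥|/q; then ab = |V|/q,
-- and a - b is the total Gauss sum divided by q.
open Classical in
theorem quadratic_energy_nonneg [Fintype k] (hψ : ψ ≠ 1)
    (hQ : ∀ v, Q v = 0 → (∀ w, polar Q v w = 0) → v = 0)
    (W : Submodule k V) (hW : ∀ w ∈ W, Q w = 0) (hmax : ∀ v ∈ polarOrth Q W, Q v = 0 → v ∈ W)
    (u : V → ℝ) (hu : IsScaleInvariant k u) (huQ : ∀ x, Q x ≠ 0 → u x = 0) :
    0 ≤ ∑ x, u x * (∑ y, u y * ψ (polar Q x y)).re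
      + (Fintype.card (polarOrth Q W) / Fintype.card k : ℝ) * ∑ x, u x ^ 2 := by
  set q : ℝ := (Fintype.card k : ℝ) with hq
  have hq0 : 0 < q := by simp [hq, Fintype.card_pos]
  set a : ℝ := (Fintype.card W : ℝ) with ha
  set c : ℝ := (Fintype.card (polarOrth Q W) : ℝ) with hc
  have ha0 : 0 < a := by simp [ha, Fintype.card_pos]
  have hc0 : 0 < c := by simp [hc, Fintype.card_pos]
  have hreal (x : V) := hu.ofReal_re_sum ψ (polarBilin Q x)
  simp only [polarBilin_apply_apply] at hreal
  refine sum_mul_add_nonneg (Finset.univ.filter fun x => Q x = 0) (fun x y => ψ (polar Q x y)) u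
    (fun x => (∑ y, u y * ψ (polar Q x y)).re) a (c / q) ha0 (by positivity) (by simpa using huQ)
    (fun x _ => hreal x) fun x hx => ?_
  have hx0 : Q x = 0 := by simpa using hx
  simp_rw [hreal]
  -- The condition Q y = 0 is detected by summing ψ(t Q y) over all t.
  have hind (F : V → ℂ) : (q : ℂ) * ∑ y with Q y = 0, F y = ∑ t, ∑ v, ψ (t * Q v) * F v := by
    rw [Finset.sum_comm]
    simp_rw [← Finset.sum_mul, sum_addChar_mul hψ, ite_mul, zero_mul]
    rw [← Finset.sum_filter, ← Finset.mul_sum]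
    simp [hq]
  -- Completing the square: shift v by t⁻¹(x + z).
  have hinner (z : V) (t : k) (ht : t ≠ 0) :
      ∑ v, ψ (t * Q v) * ψ (polar Q v (x + z)) =
        (∑ v, ψ (t * Q v)) * ψ (-t⁻¹ * Q (x + z)) := by
    rw [← Equiv.sum_comp (Equiv.addRight (t⁻¹ • (x + z))) (fun v => ψ (t * Q v)), Finset.sum_mul]
    refine Finset.sum_congr rfl fun v _ => ?_
    rw [← AddChar.map_add_eq_mul, ← AddChar.map_add_eq_mul, Equiv.coe_addRight,
      QuadraticMap.map_add Q v, polar_smul_right, QuadraticMap.map_smul]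
    congr 1
    simp only [smul_eq_mul]
    field_simp
    ring
  have hzero (z : V) (hz : Q z = 0) : ∑ v, ψ (polar Q v (x + z))
      = if z = -x then (Fintype.card V : ℂ) else 0 := by
    have h := sum_addChar_linear hψ (polarBilin Q (x + z))
    have h3 : polarBilin Q (x + z) = 0 ↔ z = -x := by
      constructor
      · intro h
        have h4 (w : V) : polar Q (x + z) w = 0 := DFunLike.congr_fun h w
        have h5 : polar Q x z = 0 := by
          have := h4 z
          rw [polar_add_left, polar_self, hz, smul_zero, add_zero] at this
          exact this
        have := hQ (x + z) (by rw [QuadraticMap.map_add Q x, hx0, hz, h5]; simp) h4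
        exact (neg_eq_of_add_eq_zero_right this).symm
      · rintro rfl
        simp
    simp only [h3] at h
    rw [← h]
    exact Finset.sum_congr rfl fun v _ => by rw [polar_comm]; rfl
  have hcard : (a : ℂ) * c = Fintype.card V := by
    have := card_mul_card_polarOrth Q hψ hQ W hW
    rw [ha, hc]
    exact_mod_cast this
  have hsum := sum_sum_addChar_quadratic Q hψ W hW hmax
  have hqC : (q : ℂ) ≠ 0 := by exact_mod_cast hq0.ne'
  -- The term t = 0 yields |V| u(x). In the others Q(x + z) reduces to the polar form, since x and z
  -- are singular, and scale invariance makes the transform independent of t, so only the sum of the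
  -- Gauss sums matters.
  have key : (q : ℂ) * ∑ y with Q y = 0, ψ (polar Q y x) * ∑ z, u z * ψ (polar Q y z)
      = Fintype.card V * u x + (q * a - c) * ∑ z, u z * ψ (polar Q x z) := by
    calc (q : ℂ) * ∑ y with Q y = 0, ψ (polar Q y x) * ∑ z, u z * ψ (polar Q y z)
        = ∑ z, u z * (q * ∑ y with Q y = 0, ψ (polar Q y (x + z))) := by
          simp_rw [Finset.mul_sum]
          rw [Finset.sum_comm]
          refine Finset.sum_congr rfl fun z _ => Finset.sum_congr rfl fun y _ => ?_
          rw [polar_add_right, AddChar.map_add_eq_mul]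
          ring
      _ = ∑ z, u z * ((if z = -x then (Fintype.card V : ℂ) else 0) +
            ∑ t ∈ Finset.univ.erase (0 : k), (∑ v, ψ (t * Q v)) * ψ (-t⁻¹ * polar Q x z)) := by
          refine Finset.sum_congr rfl fun z _ => ?_
          by_cases hz : Q z = 0
          · rw [hind, ← Finset.add_sum_erase _ _ (Finset.mem_univ 0), ← hzero z hz]
            congr 2
            · simp
            · refine Finset.sum_congr rfl fun t ht => ?_
              rw [hinner z t (Finset.ne_of_mem_erase ht), QuadraticMap.map_add Q x, hx0, hz]
              simp
          · simp [huQ z hz]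
      _ = Fintype.card V * u x + ∑ t ∈ Finset.univ.erase (0 : k), (∑ v, ψ (t * Q v)) *
            ∑ z, u z * ψ (-t⁻¹ * polar Q x z) := by
          simp_rw [mul_add, Finset.sum_add_distrib, mul_ite, mul_zero, Finset.sum_ite_eq',
            Finset.mem_univ, if_true, hu.neg, Finset.mul_sum (s := Finset.univ.erase (0 : k))]
          rw [Finset.sum_comm, mul_comm]
          congr 1
          refine Finset.sum_congr rfl fun t _ => ?_
          rw [Finset.mul_sum]
          exact Finset.sum_congr rfl fun z _ => by ring
      _ = _ := by
          rw [← show _ = (q * a - c : ℂ) from hsum, Finset.sum_mul]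
          congr 1
          refine Finset.sum_congr rfl fun t ht => ?_
          rw [← hu.sum_smul (fun z => ψ (polar Q x z))
            (neg_ne_zero.mpr (inv_ne_zero (Finset.ne_of_mem_erase ht)))]
          simp
  refine mul_left_cancel₀ hqC ?_
  rw [key, ← hcard]
  push_cast
  field_simp
  ring

end Quadratic

/-! ### Forms, totally singular subspaces and generators -/

namespace PolarForm

section Basic

variable {K V : Type*} [Field K] [AddCommGroup V] [Module K V] (f : PolarForm K V)

/-- The linear functional `y ↦ B x y`, where `B` is the sesquilinear form of the polar space,
respectively the polar form of its quadratic form. -/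
def form (x : V) : V →ₗ[K] K :=
  match f with
  | alternating B _ _ => B x
  | hermitian _ _ _ B _ _ => B x
  | quadratic Q _ => QuadraticMap.polarBilin Q x

/-- Isotropic, respectively singular, vectors. -/
def IsSingular (x : V) : Prop :=
  match f with
  | alternating _ _ _ => True
  | hermitian _ _ _ B _ _ => B x x = 0
  | quadratic Q _ => Q x = 0

theorem form_add_left (x y : V) : f.form (x + y) = f.form x + f.form y := by
  cases f <;> simp [form]

theorem form_zero_left : f.form 0 = 0 := by
  cases f <;> simp [form]

/-- The scalar is left unspecified because Hermitian forms are semilinear in the first variable. -/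
theorem form_smul_left (c : K) (x : V) : ∃ d : K, f.form (c • x) = d • f.form x := by
  cases f with
  | alternating B _ _ => exact ⟨c, by simp [form]⟩
  | hermitian τ _ _ B _ _ => exact ⟨τ c, by simp [form]⟩
  | quadratic Q _ => exact ⟨c, by simp [form]⟩

theorem form_smul_left_eq_zero {x y : V} (c : K) (h : f.form x y = 0) :
    f.form (c • x) y = 0 := by
  obtain ⟨d, hd⟩ := f.form_smul_left c x
  simp [hd, h]

theorem form_comm {x y : V} (h : f.form x y = 0) : f.form y x = 0 := by
  cases f with
  | alternating B hB _ =>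
    simp only [form] at h ⊢
    rw [← hB.neg, h, neg_zero]
  | hermitian τ _ _ B hB _ =>
    simp only [form] at h ⊢
    rw [← hB.eq, h, map_zero]
  | quadratic Q _ =>
    simp only [form, QuadraticMap.polarBilin_apply_apply] at h ⊢
    rw [QuadraticMap.polar_comm, h]

theorem isSingular_zero : f.IsSingular 0 := by
  cases f <;> simp [IsSingular]

variable {f}

theorem IsSingular.smul {x : V} (h : f.IsSingular x) (c : K) : f.IsSingular (c • x) := by
  cases f with
  | alternating => trivial
  | hermitian τ _ _ B _ _ =>
    simp only [IsSingular] at h ⊢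
    simp [h]
  | quadratic Q _ =>
    simp only [IsSingular] at h ⊢
    rw [QuadraticMap.map_smul, h, smul_zero]

theorem IsSingular.add {x y : V} (hx : f.IsSingular x) (hy : f.IsSingular y)
    (hxy : f.form x y = 0) : f.IsSingular (x + y) := by
  have hyx := f.form_comm hxy
  cases f with
  | alternating => trivial
  | hermitian τ _ _ B _ _ =>
    simp only [IsSingular, form] at *
    simp [hx, hy, hxy, hyx]
  | quadratic Q _ =>
    simp only [IsSingular, form, QuadraticMap.polarBilin_apply_apply] at *
    rw [QuadraticMap.map_add Q, hx, hy, hxy]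
    simp

theorem IsSingular.form_self {x : V} (h : f.IsSingular x) : f.form x x = 0 := by
  cases f with
  | alternating B hB => exact hB x
  | hermitian τ _ _ B _ _ => exact h
  | quadratic Q _ =>
    simp only [IsSingular] at h
    simp [form, h]

theorem IsSingular.eq_zero_of_form {x : V} (h : f.IsSingular x) (hx : ∀ y, f.form x y = 0) :
    x = 0 := by
  cases f with
  | alternating B _ hB => exact hB.1 x hx
  | hermitian τ _ _ B _ hB => exact hB.1 x hx
  | quadratic Q hQ => exact hQ x h hx

theorem isTotallySingular_iff {W : Submodule K V} :
    f.IsTotallySingular W ↔ (∀ x ∈ W, f.IsSingular x) ∧ ∀ x ∈ W, ∀ y ∈ W, f.form x y = 0 := by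
  cases f with
  | alternating B hB => simp [IsTotallySingular, IsSingular, form]
  | hermitian τ _ _ B _ _ =>
    exact ⟨fun h => ⟨fun x hx => h x hx x hx, h⟩, fun h => h.2⟩
  | quadratic Q _ =>
    refine ⟨fun h => ⟨h, fun x hx y hy => ?_⟩, fun h => h.1⟩
    simp [form, QuadraticMap.polar, h _ (W.add_mem hx hy), h x hx, h y hy]

theorem isTotallySingular_bot : f.IsTotallySingular ⊥ := by
  rw [isTotallySingular_iff]
  simp [isSingular_zero]

theorem IsTotallySingular.mono {W W' : Submodule K V} (h : f.IsTotallySingular W)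
    (hle : W' ≤ W) : f.IsTotallySingular W' := by
  rw [isTotallySingular_iff] at h ⊢
  exact ⟨fun x hx => h.1 x (hle hx), fun x hx y hy => h.2 x (hle hx) y (hle hy)⟩

theorem IsTotallySingular.sup_span {W : Submodule K V} (hW : f.IsTotallySingular W) {v : V}
    (hv : f.IsSingular v) (hvW : ∀ w ∈ W, f.form v w = 0) :
    f.IsTotallySingular (W ⊔ K ∙ v) := by
  rw [isTotallySingular_iff] at hW ⊢
  have hwv (w) (hw : w ∈ W) : f.form w v = 0 := f.form_comm (hvW w hw)
  constructor
  · intro x hx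
    obtain ⟨w, hw, z, hz, rfl⟩ := Submodule.mem_sup.mp hx
    obtain ⟨c, rfl⟩ := Submodule.mem_span_singleton.mp hz
    exact (hW.1 w hw).add (hv.smul c) (by rw [map_smul, hwv w hw, smul_zero])
  · intro x hx y hy
    obtain ⟨w, hw, z, hz, rfl⟩ := Submodule.mem_sup.mp hx
    obtain ⟨c, rfl⟩ := Submodule.mem_span_singleton.mp hz
    obtain ⟨w', hw', z', hz', rfl⟩ := Submodule.mem_sup.mp hy
    obtain ⟨c', rfl⟩ := Submodule.mem_span_singleton.mp hz'
    have h1 : f.form (c • v) w' = 0 := f.form_smul_left_eq_zero c (hvW w' hw')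
    have h2 : f.form (c • v) v = 0 := f.form_smul_left_eq_zero c hv.form_self
    simp [form_add_left, h1, h2, hW.2 w hw w' hw', hwv w hw]

theorem isTotallySingular_span_iff {v : V} : f.IsTotallySingular (K ∙ v) ↔ f.IsSingular v := by
  refine ⟨fun h => (isTotallySingular_iff.mp h).1 v (Submodule.mem_span_singleton_self v),
    fun h => ?_⟩
  have := isTotallySingular_bot.sup_span h (by simp)
  rwa [bot_sup_eq] at this

end Basic

section Rank

variable {K V : Type*} [Field K] [AddCommGroup V] [Module K V] [FiniteDimensional K V]
  {f : PolarForm K V}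

theorem bddAbove_finrank :
    BddAbove {d : ℕ | ∃ W : Submodule K V, f.IsTotallySingular W ∧ finrank K W = d} :=
  ⟨finrank K V, by rintro d ⟨W, -, rfl⟩; exact W.finrank_le⟩

theorem IsTotallySingular.finrank_le_rank {W : Submodule K V} (h : f.IsTotallySingular W) :
    finrank K W ≤ f.rank :=
  le_csSup bddAbove_finrank ⟨W, h, rfl⟩

variable (f) in
theorem exists_isGenerator : ∃ W, f.IsGenerator W :=
  Nat.sSup_mem (s := {d | ∃ W : Submodule K V, f.IsTotallySingular W ∧ finrank K W = d})
    ⟨0, ⊥, isTotallySingular_bot, by simp⟩ bddAbove_finrank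

theorem finrank_sup_span_singleton {W : Submodule K V} {v : V} (hv : v ∉ W) :
    finrank K ↥(W ⊔ K ∙ v) = finrank K W + 1 := by
  have hv0 : v ≠ 0 := fun h => hv (h ▸ W.zero_mem)
  have h := Submodule.finrank_sup_add_finrank_inf_eq W (K ∙ v)
  have hd : W ⊓ K ∙ v = ⊥ := by
    rw [← disjoint_iff]
    exact (Submodule.disjoint_span_singleton' hv0).mpr hv
  rwa [hd, finrank_bot, add_zero, finrank_span_singleton hv0] at h

theorem finrank_le_finrank_inf_ker (W : Submodule K V) (l : V →ₗ[K] K) :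
    finrank K W ≤ finrank K ↥(W ⊓ LinearMap.ker l) + 1 := by
  have h := Submodule.finrank_sup_add_finrank_inf_eq W (LinearMap.ker l)
  have h1 := LinearMap.finrank_range_add_finrank_ker l
  have h2 := (LinearMap.range l).finrank_le
  have h3 := (W ⊔ LinearMap.ker l).finrank_le
  simp only [finrank_self] at h2
  omega

theorem IsGenerator.mem_of_perp {W : Submodule K V} (hW : f.IsGenerator W) {v : V}
    (hv : f.IsSingular v) (hvW : ∀ w ∈ W, f.form v w = 0) : v ∈ W := by
  by_contra hmem
  have h := (hW.1.sup_span hv hvW).finrank_le_rank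
  rw [finrank_sup_span_singleton hmem, hW.2] at h
  omega

/-- If v is not in `W`, intersecting `W` with v^⊥ loses at most one dimension, and adjoining v
regains it. -/
theorem IsGenerator.exists_sup_span_le {W T : Submodule K V} (hW : f.IsGenerator W) (hT : T ≤ W)
    {v : V} (hv : f.IsSingular v) (hvT : ∀ w ∈ T, f.form v w = 0) :
    ∃ W', f.IsGenerator W' ∧ T ⊔ K ∙ v ≤ W' := by
  by_cases hmem : v ∈ W
  · exact ⟨W, hW, sup_le hT (by simpa using hmem)⟩
  · have h1 : f.IsTotallySingular ((W ⊓ LinearMap.ker (f.form v)) ⊔ K ∙ v) :=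
      (hW.1.mono inf_le_left).sup_span hv fun w hw => hw.2
    refine ⟨_, ⟨h1, le_antisymm h1.finrank_le_rank ?_⟩,
      sup_le_sup_right (le_inf hT fun w hw => hvT w hw) _⟩
    rw [finrank_sup_span_singleton fun h => hmem (Submodule.mem_inf.mp h).1,
      ← hW.2]
    exact finrank_le_finrank_inf_ker W _

end Rank

/-! ### Restriction of forms and the residue of a point -/

section Comap

variable {K V V' : Type*} [Field K] [AddCommGroup V] [Module K V] [AddCommGroup V'] [Module K V']

/-- The restriction of a form along an injective linear map, provided that a vector orthogonal to
the image of the map is orthogonal to the whole space if it lies in that image. -/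
def comap (f : PolarForm K V) (i : V' →ₗ[K] V) (hi : Function.Injective i)
    (h : ∀ x, (∀ y, f.form (i x) (i y) = 0) → ∀ v, f.form (i x) v = 0) : PolarForm K V' :=
  match f with
  | alternating B hB hnd =>
    alternating (B.compl₁₂ i i) (fun x => hB (i x)) (by
      have hl : (B.compl₁₂ i i).SeparatingLeft := fun x hx =>
        (map_eq_zero_iff i hi).mp (hnd.1 (i x) (h x hx))
      exact ⟨hl, fun x hx => hl x fun y => by
        have := hB.neg (i y) (i x)
        simpa [show B (i y) (i x) = 0 from hx y] using this.symm⟩)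
  | hermitian τ hτ hτ1 B hB hnd =>
    hermitian τ hτ hτ1
      (LinearMap.mk₂'ₛₗ τ (RingHom.id K) (fun x y => B (i x) (i y)) (by simp) (by simp) (by simp)
        (by simp)) ⟨fun x y => hB.eq (i x) (i y)⟩ (by
      have hl (x : V') (hx : ∀ y, B (i x) (i y) = 0) : x = 0 :=
        (map_eq_zero_iff i hi).mp (hnd.1 (i x) (h x hx))
      refine ⟨hl, fun x hx => hl x fun y => ?_⟩
      rw [← hB.eq, show B (i y) (i x) = 0 from hx y, map_zero])
  | quadratic Q hQ =>
    quadratic (Q.comp i) fun x hx hx' => (map_eq_zero_iff i hi).mp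
      (hQ (i x) hx (h x fun y => by
        have := hx' y
        simp only [QuadraticMap.polar, QuadraticMap.comp_apply, map_add] at this
        exact this))

variable {f : PolarForm K V} {i : V' →ₗ[K] V} {hi : Function.Injective i}
  {h : ∀ x, (∀ y, f.form (i x) (i y) = 0) → ∀ v, f.form (i x) v = 0}

theorem comap_form (x y : V') : (f.comap i hi h).form x y = f.form (i x) (i y) := by
  cases f with
  | alternating => rfl
  | hermitian => rfl
  | quadratic Q _ => simp [comap, form, QuadraticMap.polar]

theorem comap_isSingular (x : V') : (f.comap i hi h).IsSingular x ↔ f.IsSingular (i x) := by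
  cases f <;> rfl

theorem comap_isTotallySingular (Z : Submodule K V') :
    (f.comap i hi h).IsTotallySingular Z ↔ f.IsTotallySingular (Z.map i) := by
  simp [isTotallySingular_iff, comap_form, comap_isSingular]

/-- For quadrics the type depends only on the parity of n and on whether n = 2r; both survive n ↦ n
- 2, r ↦ r - 1. -/
theorem comap_type (hn : finrank K V = finrank K V' + 2)
    (hr : f.rank = (f.comap i hi h).rank + 1) : (f.comap i hi h).type = f.type := by
  cases f with
  | alternating => rfl
  | hermitian => rfl
  | quadratic Q hQ =>
    have h1 : Odd (finrank K V) ↔ Odd (finrank K V') := by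
      rw [hn, Nat.odd_add]
      simp
    have h2 : 2 * (quadratic Q hQ).rank = finrank K V ↔
        2 * ((quadratic Q hQ).comap i hi h).rank = finrank K V' := by
      rw [hn, hr]
      omega
    simp only [type, h1, h2]
    rfl

end Comap

end PolarForm

namespace PolarForm

variable {K V : Type*} [Field K] [AddCommGroup V] [Module K V]

section Residue

variable {V' : Type*} [AddCommGroup V'] [Module K V']
  {f : PolarForm K V} {e : V} {i : V' →ₗ[K] V}

/-- The subspace e^⊥ ∩ g^⊥, with g not orthogonal to e, is a concrete model of e^⊥/e. It is given
coordinates because `maxPartialOvoid` refers to coordinate spaces. -/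
theorem exists_perp_embedding [FiniteDimensional K V] (f : PolarForm K V) {e : V}
    (he : f.IsSingular e) (he0 : e ≠ 0) :
    ∃ (n : ℕ) (i : (Fin n → K) →ₗ[K] V) (g : V), finrank K V = n + 2 ∧ Function.Injective i ∧
      f.form e g ≠ 0 ∧ LinearMap.range i = LinearMap.ker (f.form e) ⊓ LinearMap.ker (f.form g) := by
  obtain ⟨g, hg⟩ : ∃ g, f.form e g ≠ 0 := by
    by_contra! h
    exact he0 (he.eq_zero_of_form h)
  have hg' : f.form g e ≠ 0 := fun h => hg (f.form_comm h)
  set l : V →ₗ[K] K × K := (f.form e).prod (f.form g) with hl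
  have hker : LinearMap.ker l = LinearMap.ker (f.form e) ⊓ LinearMap.ker (f.form g) :=
    LinearMap.ker_prod _ _
  have hsurj : LinearMap.range l = ⊤ := by
    rw [LinearMap.range_eq_top]
    rintro ⟨a, b⟩
    refine ⟨(a / f.form e g) • g + ((b - a / f.form e g * f.form g g) / f.form g e) • e, ?_⟩
    simp [hl, he.form_self, hg, hg']
  have hdim := LinearMap.finrank_range_add_finrank_ker l
  rw [hsurj, finrank_top, finrank_prod, finrank_self, hker] at hdim
  set U := LinearMap.ker (f.form e) ⊓ LinearMap.ker (f.form g) with hU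
  refine ⟨finrank K U, U.subtype ∘ₗ (finBasis K U).equivFun.symm.toLinearMap, g, by omega,
    U.injective_subtype.comp (LinearEquiv.injective _), hg, ?_⟩
  rw [LinearMap.range_comp_of_range_eq_top _ (LinearEquiv.range _), Submodule.range_subtype]

/-- The space is spanned by e, g and the range of `i`, and vectors of that range are already
orthogonal to e and g. -/
theorem perp_of_perp_range (he : f.IsSingular e) {g : V} (hg : f.form e g ≠ 0)
    (hr : LinearMap.range i = LinearMap.ker (f.form e) ⊓ LinearMap.ker (f.form g)) (x : V')
    (hx : ∀ y, f.form (i x) (i y) = 0) (v : V) : f.form (i x) v = 0 := by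
  have hix : i x ∈ LinearMap.range i := ⟨x, rfl⟩
  rw [hr] at hix
  have hg' : f.form g e ≠ 0 := fun h => hg (f.form_comm h)
  have hxe : f.form (i x) e = 0 := f.form_comm hix.1
  have hxg : f.form (i x) g = 0 := f.form_comm hix.2
  set a := f.form e v / f.form e g
  set b := (f.form g v - a * f.form g g) / f.form g e
  have hmem : v - a • g - b • e ∈ LinearMap.range i := by
    rw [hr]
    constructor <;> simp [a, b, he.form_self, hg, hg']
  obtain ⟨y, hy⟩ := hmem
  have h := hx y
  rw [hy] at h
  simpa [hxe, hxg] using h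

variable {hi : Function.Injective i}
  {h : ∀ x, (∀ y, f.form (i x) (i y) = 0) → ∀ v, f.form (i x) v = 0}

theorem isTotallySingular_map_sup (he : f.IsSingular e) (hie : ∀ x, f.form e (i x) = 0)
    {Z : Submodule K V'} (hZ : (f.comap i hi h).IsTotallySingular Z) :
    f.IsTotallySingular (Z.map i ⊔ K ∙ e) := by
  rw [comap_isTotallySingular] at hZ
  refine hZ.sup_span he ?_
  rintro w ⟨x, -, rfl⟩
  exact hie x

theorem finrank_map_sup [FiniteDimensional K V] (hi : Function.Injective i) (hei : e ∉ LinearMap.range i)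
    (Z : Submodule K V') : finrank K ↥(Z.map i ⊔ K ∙ e) = finrank K Z + 1 := by
  rw [finrank_sup_span_singleton fun hm => hei (LinearMap.map_le_range hm),
    ← (Submodule.equivMapOfInjective i hi Z).finrank_eq]

/-- Some generator contains e; cutting it with g^⊥ costs at most one dimension and lands in the
residue. Conversely, adjoining e to a residual generator adds one. -/
theorem rank_eq_comap_rank_add_one [FiniteDimensional K V] [FiniteDimensional K V']
    (he : f.IsSingular e) (hie : ∀ x, f.form e (i x) = 0)
    (hei : e ∉ LinearMap.range i) {g : V}
    (hr : LinearMap.range i = LinearMap.ker (f.form e) ⊓ LinearMap.ker (f.form g)) :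
    f.rank = (f.comap i hi h).rank + 1 := by
  apply le_antisymm
  · obtain ⟨W₀, hW₀⟩ := f.exists_isGenerator
    obtain ⟨W, hW, hle⟩ := hW₀.exists_sup_span_le bot_le he (by simp)
    have heW : e ∈ W := hle (by simp [Submodule.mem_span_singleton_self])
    have hWe : W ≤ LinearMap.ker (f.form e) := fun w hw =>
      (isTotallySingular_iff.mp hW.1).2 e heW w hw
    have hmap : (W.comap i).map i = W ⊓ LinearMap.ker (f.form g) := by
      rw [Submodule.map_comap_eq, hr, inf_comm, ← inf_assoc, inf_eq_left.mpr hWe]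
    have h1 : (f.comap i hi h).IsTotallySingular (W.comap i) := by
      rw [comap_isTotallySingular, hmap]
      exact hW.1.mono inf_le_left
    have h2 := finrank_le_finrank_inf_ker W (f.form g)
    rw [← hmap, ← (Submodule.equivMapOfInjective i hi _).finrank_eq, hW.2] at h2
    exact h2.trans (Nat.add_le_add_right h1.finrank_le_rank 1)
  · obtain ⟨Z, hZ⟩ := (f.comap i hi h).exists_isGenerator
    have h1 := (isTotallySingular_map_sup he hie hZ.1).finrank_le_rank
    rwa [finrank_map_sup hi hei, hZ.2] at h1

end Residue

theorem point_le_iff {P : ℙ K V} {W : Submodule K V} : P.submodule ≤ W ↔ P.rep ∈ W := by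
  rw [Projectivization.submodule_eq, Submodule.span_singleton_le_iff_mem]

theorem isTotallySingular_point_iff {f : PolarForm K V} {P : ℙ K V} :
    f.IsTotallySingular P.submodule ↔ f.IsSingular P.rep := by
  rw [Projectivization.submodule_eq, isTotallySingular_span_iff]

theorem eq_of_rep_eq_smul {P P' : ℙ K V} {c : K} (h : P.rep = c • P'.rep) : P = P' := by
  rw [← P.mk_rep, ← P'.mk_rep, Projectivization.mk_eq_mk_iff']
  exact ⟨c, h.symm⟩

theorem IsPartialOvoid.eq_of_isGenerator {f : PolarForm K V} {O : Set (ℙ K V)}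
    (hO : f.IsPartialOvoid 2 O) {W : Submodule K V} (hW : f.IsGenerator W) {E P P' : ℙ K V}
    (hE : E ∈ O) (hP : P ∈ O) (hP' : P' ∈ O) (hEW : E.submodule ≤ W) (hPW : P.submodule ≤ W)
    (hPW' : P'.submodule ≤ W) (hPE : P ≠ E) (hPE' : P' ≠ E) : P = P' := by
  by_contra hne
  have h1 := hO.2 W hW
  have h2 : ({E, P, P'} : Set (ℙ K V)) ⊆ {P ∈ O | P.submodule ≤ W} := by
    rintro _ (rfl | rfl | rfl)
    exacts [⟨hE, hEW⟩, ⟨hP, hPW⟩, ⟨hP', hPW'⟩]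
  have h3 := (Set.encard_le_encard h2).trans h1
  rw [Set.encard_eq_three.mpr ⟨E, P, P', hPE.symm, hPE'.symm, hne, rfl⟩] at h3
  norm_num at h3

theorem finite_projectivization [Finite K] (W : Type*) [AddCommGroup W] [Module K W]
    [FiniteDimensional K W] : Finite (ℙ K W) := by
  have : Finite W := Module.finite_of_finite K
  infer_instance

theorem ncard_le_maxPartialOvoid [Finite K] {n : ℕ} (f : PolarForm K (Fin n → K))
    (O : Set (ℙ K (Fin n → K))) (hO : f.IsPartialOvoid 1 O) :
    O.ncard ≤ maxPartialOvoid K f.type n := by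
  have : Finite (ℙ K (Fin n → K)) := finite_projectivization _
  -- The number of points bounds all sizes, so the supremum in ℕ is a genuine one.
  refine le_csSup ⟨Nat.card (ℙ K (Fin n → K)), ?_⟩ ⟨f, rfl, O, hO, rfl⟩
  rintro s ⟨-, -, O', -, rfl⟩
  exact Set.ncard_le_card O'

/-- A point of a partial `2`-ovoid is orthogonal to few other points: those points form, in the
residue of the given point, a partial ovoid. -/
theorem IsPartialOvoid.ncard_perp_le [Finite K] [FiniteDimensional K V] {f : PolarForm K V} {O : Set (ℙ K V)}
    (hO : f.IsPartialOvoid 2 O) {E : ℙ K V} (hE : E ∈ O) :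
    {P ∈ O | P ≠ E ∧ f.form E.rep P.rep = 0}.ncard
      ≤ maxPartialOvoid K f.type (finrank K V - 2) := by
  have he : f.IsSingular E.rep := isTotallySingular_point_iff.mp (hO.1 E hE)
  obtain ⟨n, i, g, hn, hi, hg, hr⟩ := f.exists_perp_embedding he E.rep_nonzero
  have hg' : f.form g E.rep ≠ 0 := fun h => hg (f.form_comm h)
  have h := perp_of_perp_range he hg hr
  have hie (x) : f.form E.rep (i x) = 0 := (hr.le ⟨x, rfl⟩ : _ ∈ _ ⊓ _).1
  have hei : E.rep ∉ LinearMap.range i := fun hm => hg' (hr.le hm : _ ∈ _ ⊓ _).2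
  set f' := f.comap i hi h with hf'
  have hrank : f.rank = f'.rank + 1 := rank_eq_comap_rank_add_one he hie hei hr
  have hgen (Z) (hZ : f'.IsGenerator Z) : f.IsGenerator (Z.map i ⊔ K ∙ E.rep) :=
    ⟨isTotallySingular_map_sup he hie hZ.1, by rw [finrank_map_sup hi hei, hZ.2, hrank]⟩
  -- Projection from E is single-valued: a line through E and P contains at most one residual point,
  -- because E lies outside the range of `i`.
  have hind (P : ℙ K V) (P₁ P₂ : ℙ K (Fin n → K)) (hPE : P ≠ E)
      (h1 : P.rep ∈ P₁.submodule.map i ⊔ K ∙ E.rep)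
      (h2 : P.rep ∈ P₂.submodule.map i ⊔ K ∙ E.rep) : P₁ = P₂ := by
    have hdec (P₁ : ℙ K (Fin n → K)) (h1 : P.rep ∈ P₁.submodule.map i ⊔ K ∙ E.rep) :
        ∃ c d : K, d ≠ 0 ∧ P.rep = i (d • P₁.rep) + c • E.rep := by
      obtain ⟨_, ⟨x, hx, rfl⟩, z, hz, hxz⟩ := Submodule.mem_sup.mp h1
      obtain ⟨c, rfl⟩ := Submodule.mem_span_singleton.mp hz
      rw [SetLike.mem_coe, Projectivization.submodule_eq] at hx
      obtain ⟨d, rfl⟩ := Submodule.mem_span_singleton.mp hx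
      refine ⟨c, d, ?_, hxz.symm⟩
      rintro rfl
      exact hPE (eq_of_rep_eq_smul (c := c) (by simpa using hxz.symm))
    obtain ⟨c, d, hd, h3⟩ := hdec P₁ h1
    obtain ⟨c', d', hd', h4⟩ := hdec P₂ h2
    have h5 : i (d • P₁.rep - d' • P₂.rep) = (c' - c) • E.rep := by
      rw [map_sub, sub_smul, sub_eq_sub_iff_add_eq_add, add_comm (c' • _), ← h4, ← h3]
    have h6 : c' - c = 0 := by
      by_contra hne
      exact hei ⟨(c' - c)⁻¹ • (d • P₁.rep - d' • P₂.rep), by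
        rw [map_smul, h5, inv_smul_smul₀ hne]⟩
    rw [h6, zero_smul, map_eq_zero_iff i hi, sub_eq_zero] at h5
    refine eq_of_rep_eq_smul (c := d⁻¹ * d') ?_
    rw [mul_smul, ← h5, inv_smul_smul₀ hd]
  set O' : Set (ℙ K (Fin n → K)) := {P' | f'.IsTotallySingular P'.submodule ∧
    ∃ P ∈ O, P ≠ E ∧ P.rep ∈ P'.submodule.map i ⊔ K ∙ E.rep} with hO'
  have hO'1 : f'.IsPartialOvoid 1 O' := by
    refine ⟨fun P' hP' => hP'.1, fun Z hZ => ?_⟩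
    rw [Nat.cast_one, Set.encard_le_one_iff]
    rintro P₁ P₂ ⟨⟨-, Q₁, hQ₁, hne₁, hm₁⟩, hZ₁⟩ ⟨⟨-, Q₂, hQ₂, hne₂, hm₂⟩, hZ₂⟩
    have hle (P₁ : ℙ K (Fin n → K)) (hZ₁ : P₁.submodule ≤ Z) :
        P₁.submodule.map i ⊔ K ∙ E.rep ≤ Z.map i ⊔ K ∙ E.rep :=
      sup_le_sup_right (Submodule.map_mono hZ₁) _
    -- The lift of `Z` already contains E, so it has room for only one more point of `O`.
    have hQ : Q₁ = Q₂ := hO.eq_of_isGenerator (hgen Z hZ) hE hQ₁ hQ₂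
      (E.submodule_eq ▸ le_sup_right) (point_le_iff.mpr (hle P₁ hZ₁ hm₁))
      (point_le_iff.mpr (hle P₂ hZ₂ hm₂)) hne₁ hne₂
    exact hind Q₁ P₁ P₂ hne₁ hm₁ (hQ ▸ hm₂)
  have hex (P : ℙ K V) (hP : P ∈ {P ∈ O | P ≠ E ∧ f.form E.rep P.rep = 0}) :
      ∃ P' ∈ O', P.rep ∈ P'.submodule.map i ⊔ K ∙ E.rep := by
    obtain ⟨hPO, hPE, hperp⟩ := hP
    set c := f.form g P.rep / f.form g E.rep
    have hmem : P.rep - c • E.rep ∈ LinearMap.range i := by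
      rw [hr]
      constructor <;> simp [c, he.form_self, hperp, hg']
    obtain ⟨x, hx⟩ := hmem
    have hx0 : x ≠ 0 := by
      rintro rfl
      rw [map_zero, eq_comm, sub_eq_zero] at hx
      exact hPE (eq_of_rep_eq_smul hx)
    have hm : P.rep ∈ (Projectivization.mk K x hx0).submodule.map i ⊔ K ∙ E.rep := by
      rw [Projectivization.submodule_mk, ← sub_add_cancel P.rep (c • E.rep), ← hx]
      exact Submodule.add_mem_sup ⟨x, Submodule.mem_span_singleton_self x, rfl⟩
        (Submodule.smul_mem _ _ (Submodule.mem_span_singleton_self _))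
    refine ⟨Projectivization.mk K x hx0, ⟨?_, P, hPO, hPE, hm⟩, hm⟩
    rw [Projectivization.submodule_mk, isTotallySingular_span_iff, comap_isSingular, hx,
      sub_eq_add_neg, ← neg_smul]
    refine (isTotallySingular_point_iff.mp (hO.1 P hPO)).add (he.smul _) ?_
    rw [map_smul, f.form_comm hperp, smul_zero]
  have hfin : Finite (ℙ K (Fin n → K)) := finite_projectivization _
  have hcard : {P ∈ O | P ≠ E ∧ f.form E.rep P.rep = 0}.ncard ≤ O'.ncard := by
    rcases Set.eq_empty_or_nonempty {P ∈ O | P ≠ E ∧ f.form E.rep P.rep = 0} with hem | ⟨P₀, hP₀⟩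
    · simp [hem]
    have : Nonempty (ℙ K (Fin n → K)) := ⟨(hex P₀ hP₀).choose⟩
    choose! φ hφO hφ using hex
    refine Set.ncard_le_ncard_of_injOn φ hφO ?_ (Set.toFinite _)
    -- Injectivity: points with the same projection lie with E on one totally singular line, hence
    -- in a common generator, so they coincide.
    intro P hP P' hP' heq
    have hs : f.IsSingular (i (φ P).rep) :=
      (comap_isSingular _).mp (isTotallySingular_point_iff.mp (hφO P hP).1)
    obtain ⟨W₀, hW₀⟩ := f.exists_isGenerator
    obtain ⟨W₁, hW₁, hle₁⟩ := hW₀.exists_sup_span_le bot_le hs (by simp)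
    obtain ⟨W, hW, hle⟩ := hW₁.exists_sup_span_le (T := (φ P).submodule.map i) (by
        rw [Projectivization.submodule_eq, Submodule.map_span, Set.image_singleton]
        exact le_sup_right.trans hle₁) he (by
        rintro _ ⟨x, -, rfl⟩
        exact hie x)
    exact hO.eq_of_isGenerator hW hE hP.1 hP'.1 (E.submodule_eq ▸ le_sup_right.trans hle)
      (point_le_iff.mpr (hle (hφ P hP))) (point_le_iff.mpr (hle (heq ▸ hφ P' hP')))
      hP.2.1 hP'.2.1
  have htype : f'.type = f.type := comap_type (by simpa using hn) hrank
  have hn' : finrank K V - 2 = n := by omega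
  rw [hn', ← htype]
  exact hcard.trans (ncard_le_maxPartialOvoid f' O' hO'1)

end PolarForm

/-! ### Dimension of maximal totally singular subspaces -/

section Anisotropic

variable {k V : Type*} [Field k] [AddCommGroup V] [Module k V]

/-- An anisotropic quadratic form over a finite field has dimension at most two. -/
theorem QuadraticForm.finrank_le_two_of_anisotropic [Finite k] [FiniteDimensional k V]
    (Q : QuadraticForm k V) (hQ : ∀ x, Q x = 0 → x = 0) : finrank k V ≤ 2 := by
  classical
  by_contra! hlt
  have := Fintype.ofFinite k
  set b := finBasis k V
  set B := Q.toBilin b with hB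
  set p : MvPolynomial (Fin (finrank k V)) k := ∑ i, ∑ j,
    MvPolynomial.C (B (b i) (b j)) * (MvPolynomial.X i * MvPolynomial.X j) with hp
  have hdeg : p.totalDegree ≤ 2 := by
    refine MvPolynomial.totalDegree_finsetSum_le fun i _ =>
      MvPolynomial.totalDegree_finsetSum_le fun j _ => ?_
    refine (MvPolynomial.totalDegree_mul _ _).trans ?_
    rw [MvPolynomial.totalDegree_C, zero_add]
    refine (MvPolynomial.totalDegree_mul _ _).trans ?_
    simp
  have heval (x : Fin (finrank k V) → k) :
      MvPolynomial.eval x p = Q (b.equivFun.symm x) := by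
    conv_rhs => rw [← Q.toQuadraticMap_toBilin b, LinearMap.BilinMap.toQuadraticMap_apply]
    simp only [hp, map_sum, map_mul, MvPolynomial.eval_C, MvPolynomial.eval_X,
      Basis.equivFun_symm_apply, LinearMap.sum_apply, map_smul, LinearMap.smul_apply,
      smul_eq_mul, ← hB, Finset.mul_sum]
    rw [Finset.sum_comm]
    exact Finset.sum_congr rfl fun i _ => Finset.sum_congr rfl fun j _ => by ring
  -- Chevalley–Warning: a quadratic polynomial in more than two variables has a number of zeros
  -- divisible by the characteristic, whereas anisotropy leaves exactly one.
  have hdvd := char_dvd_card_solutions (ringChar k) (f := p) (by simpa using hdeg.trans_lt hlt)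
  have hone : Fintype.card {x : Fin (finrank k V) → k // MvPolynomial.eval x p = 0} = 1 := by
    rw [Fintype.card_eq_one_iff]
    refine ⟨⟨0, by rw [heval, map_zero, QuadraticMap.map_zero]⟩, fun x => Subtype.ext ?_⟩
    exact (map_eq_zero_iff _ b.equivFun.symm.injective).mp (hQ _ ((heval x).symm.trans x.2))
  rw [hone, Nat.dvd_one] at hdvd
  exact CharP.ringChar_ne_one hdvd

open QuadraticMap in
-- By maximality, Q is anisotropic on a complement of `W` within W^⊥.
theorem finrank_polarOrth_le [Finite k] [FiniteDimensional k V]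
    (Q : QuadraticForm k V)
    (W : Submodule k V) (hmax : ∀ v ∈ polarOrth Q W, Q v = 0 → v ∈ W) :
    finrank k (polarOrth Q W) ≤ finrank k W + 2 := by
  obtain ⟨D, hD⟩ := (W.comap (polarOrth Q W).subtype).exists_isCompl
  have h1 := Submodule.finrank_add_eq_of_isCompl hD
  have h2 : finrank k D ≤ 2 := by
    refine QuadraticForm.finrank_le_two_of_anisotropic
      (Q.comp ((polarOrth Q W).subtype ∘ₗ D.subtype)) fun x hx => ?_
    have hxW : (x : polarOrth Q W) ∈ W.comap (polarOrth Q W).subtype :=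
      hmax _ (x : polarOrth Q W).2 hx
    exact Subtype.ext (Submodule.disjoint_def.mp hD.disjoint _ hxW x.2)
  have h3 : finrank k (W.comap (polarOrth Q W).subtype) ≤ finrank k W := by
    have h4 : ∀ x ∈ W.comap (polarOrth Q W).subtype, (polarOrth Q W).subtype x ∈ W :=
      fun x hx => hx
    refine LinearMap.finrank_le_finrank_of_injective
      (f := (polarOrth Q W).subtype.restrict h4) fun x y hxy => ?_
    have := congrArg Subtype.val hxy
    exact Subtype.ext (Subtype.ext this)
  omega

/-- If `Q` vanishes on `W` and `W` is maximal with this property, then transforms of functions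
supported on the singular vectors have energy bounded below. -/
theorem quadratic_energy_bound [Finite k] [Fintype V] {ψ : AddChar k ℂ} (hψ : ψ ≠ 1)
    (Q : QuadraticForm k V)
    (hQ : ∀ v, Q v = 0 → (∀ w, QuadraticMap.polar Q v w = 0) → v = 0)
    (W : Submodule k V) (hW : ∀ w ∈ W, Q w = 0) (hmax : ∀ v ∈ polarOrth Q W, Q v = 0 → v ∈ W)
    (m : ℕ) (hm : finrank k V ≤ finrank k W + m + 1) (u : V → ℝ) (hu : IsScaleInvariant k u)
    (huQ : ∀ x, Q x ≠ 0 → u x = 0) :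
    0 ≤ ∑ x, u x * (∑ y, u y * ψ (QuadraticMap.polar Q x y)).re
      + (Nat.card k : ℝ) ^ m * ∑ x, u x ^ 2 := by
  classical
  have := Fintype.ofFinite k
  have hq : 1 ≤ Fintype.card k := Fintype.card_pos
  refine (quadratic_energy_nonneg Q hψ hQ W hW hmax u hu huQ).trans ?_
  have hcard := card_mul_card_polarOrth Q hψ hQ W hW
  rw [Module.card_eq_pow_finrank (K := k) (V := W), Module.card_eq_pow_finrank (K := k) (V := V),
    Module.card_eq_pow_finrank (K := k) (V := polarOrth Q W), ← pow_add] at hcard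
  have hfin := Nat.pow_right_injective Fintype.one_lt_card hcard
  gcongr
  rw [Nat.card_eq_fintype_card, div_le_iff₀ (by exact_mod_cast hq), ← pow_succ,
    Module.card_eq_pow_finrank (K := k) (V := polarOrth Q W)]
  push_cast
  exact pow_le_pow_right₀ (by exact_mod_cast hq) (by omega)

theorem finrank_add_finrank_polarOrth [Finite k] [FiniteDimensional k V]
    (Q : QuadraticForm k V)
    (hQ : ∀ v, Q v = 0 → (∀ w, QuadraticMap.polar Q v w = 0) → v = 0)
    (W : Submodule k V) (hW : ∀ w ∈ W, Q w = 0) :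
    finrank k W + finrank k (polarOrth Q W) = finrank k V := by
  classical
  have := Fintype.ofFinite k
  have : Finite V := Module.finite_of_finite k
  have := Fintype.ofFinite V
  obtain ⟨ψ, hψ⟩ := AddChar.exists_apply_ne_zero.mpr (one_ne_zero (α := k))
  have hcard := card_mul_card_polarOrth Q (ψ := ψ) (fun h => hψ (by simp [h])) hQ W hW
  rw [Module.card_eq_pow_finrank (K := k) (V := W), Module.card_eq_pow_finrank (K := k) (V := V),
    Module.card_eq_pow_finrank (K := k) (V := polarOrth Q W), ← pow_add] at hcard
  exact Nat.pow_right_injective Fintype.one_lt_card hcard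

/-- A maximal subspace on which a quadratic form over a finite field vanishes has almost half the
dimension of the space. -/
theorem finrank_le_two_mul_add_two [Finite k] [FiniteDimensional k V]
    (Q : QuadraticForm k V)
    (hQ : ∀ v, Q v = 0 → (∀ w, QuadraticMap.polar Q v w = 0) → v = 0)
    (W : Submodule k V) (hW : ∀ w ∈ W, Q w = 0) (hmax : ∀ v ∈ polarOrth Q W, Q v = 0 → v ∈ W) :
    finrank k V ≤ 2 * finrank k W + 2 := by
  have h1 := finrank_add_finrank_polarOrth Q hQ W hW
  have h2 := finrank_polarOrth_le Q W hmax
  omega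

end Anisotropic

theorem finrank_eq_of_eq_restrictScalars {k K V : Type*} [Field k] [Field K] [Algebra k K]
    [AddCommGroup V] [Module K V] [Module k V] [IsScalarTower k K V] {W : Submodule K V}
    {W' : Submodule k V} (h : W' = W.restrictScalars k) :
    finrank k W' = finrank k K * finrank K W := by
  subst h
  exact (Module.finrank_mul_finrank k K W).symm

/-! ### Hermitian forms as quadratic forms over the fixed field -/

section FixedField

variable {K : Type*} [Field K] (τ : K →+* K)

/-- The fixed field of an endomorphism. -/
abbrev fixedSubfield : Subfield K := RingHom.eqLocusField τ (RingHom.id K)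

variable {τ}

/-- The trace to the fixed field of an involution. -/
def involutionTrace (invol : ∀ a, τ (τ a) = a) : K →ₗ[fixedSubfield τ] fixedSubfield τ where
  toFun z := ⟨z + τ z, by simp [invol, add_comm]⟩
  map_add' x y := Subtype.ext (by simp; ring)
  map_smul' c x := Subtype.ext (by
    have : τ (c : K) = c := c.2
    simp [Subfield.smul_def, this]; ring)

/-- Taking c = 1 gives τ z = -z; the condition for general c then reads (c - τ c) z = 0. -/
theorem eq_zero_of_involutionTrace (invol : ∀ a, τ (τ a) = a) (ne_id : τ ≠ RingHom.id K) {z : K}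
    (h : ∀ c, involutionTrace invol (c * z) = 0) : z = 0 := by
  have h' (c : K) : c * z + τ (c * z) = 0 := congrArg Subtype.val (h c)
  by_contra hz
  refine ne_id (RingHom.ext fun c => ?_)
  have h1 := h' 1
  have h2 := h' c
  rw [one_mul] at h1
  rw [map_mul, eq_neg_of_add_eq_zero_right h1] at h2
  have h3 : (c - τ c) * z = 0 := by rw [sub_mul, sub_eq_add_neg, ← mul_neg]; exact h2
  exact (sub_eq_zero.mp ((mul_eq_zero.mp h3).resolve_right hz)).symm

theorem finrank_fixedSubfield [Finite K] (invol : ∀ a, τ (τ a) = a) (ne_id : τ ≠ RingHom.id K) :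
    finrank (fixedSubfield τ) K = 2 := by
  obtain ⟨θ, hθ⟩ := DFunLike.ne_iff.mp ne_id
  rw [RingHom.id_apply] at hθ
  have hθ' : θ - τ θ ≠ 0 := sub_ne_zero.mpr (Ne.symm hθ)
  -- With θ moved by τ, the pair 1, θ is a basis over the fixed field; coordinates are found by
  -- solving the system formed by x and τ x.
  have hbij : Function.Bijective
      (fun p : fixedSubfield τ × fixedSubfield τ => (p.1 : K) + p.2 * θ) := by
    constructor
    · rintro ⟨a, b⟩ ⟨c, d⟩ h
      have ha : τ (a : K) = a := a.2
      have hb : τ (b : K) = b := b.2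
      have hc : τ (c : K) = c := c.2
      have hd : τ (d : K) = d := d.2
      simp only at h
      have h2 := congrArg τ h
      simp only [map_add, map_mul, ha, hb, hc, hd] at h2
      have h3 : ((b : K) - d) * (θ - τ θ) = 0 := by linear_combination h - h2
      have h4 : (b : K) = d := sub_eq_zero.mp ((mul_eq_zero.mp h3).resolve_right hθ')
      rw [h4] at h
      exact Prod.ext (Subtype.ext (add_right_cancel h)) (Subtype.ext h4)
    · intro x
      have hb : τ ((x - τ x) / (θ - τ θ)) = (x - τ x) / (θ - τ θ) := by
        rw [map_div₀, map_sub, map_sub, invol, invol, ← neg_sub x, ← neg_sub θ, neg_div_neg_eq]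
      have ha : τ (x - (x - τ x) / (θ - τ θ) * θ) = x - (x - τ x) / (θ - τ θ) * θ := by
        rw [map_sub, map_mul, hb]
        field_simp
        ring
      exact ⟨(⟨_, ha⟩, ⟨_, hb⟩), by simp⟩
  have hcard := Nat.card_congr (Equiv.ofBijective _ hbij)
  rw [Nat.card_prod, Module.natCard_eq_pow_finrank (K := fixedSubfield τ) (V := K),
    ← pow_two] at hcard
  exact (Nat.pow_right_injective Finite.one_lt_card hcard).symm

variable {V : Type*} [AddCommGroup V] [Module K V]

/-- The quadratic form `x ↦ B x x` over the fixed field attached to a Hermitian form `B`. -/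
def hermitianQuadraticForm (invol : ∀ a, τ (τ a) = a) (B : V →ₛₗ[τ] V →ₗ[K] K)
    (isSymm : B.IsSymm) : QuadraticForm (fixedSubfield τ) V :=
  have hpolar (x y : V) : QuadraticMap.polar
      (fun x => (⟨B x x, isSymm.eq x x⟩ : fixedSubfield τ)) x y = involutionTrace invol (B x y) := by
    refine Subtype.ext ?_
    simp only [QuadraticMap.polar, involutionTrace, LinearMap.coe_mk, AddHom.coe_mk,
      AddSubgroupClass.coe_sub, map_add, LinearMap.add_apply, isSymm.eq]
    ring
  QuadraticMap.ofPolar (fun x => ⟨B x x, isSymm.eq x x⟩)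
    (fun c x => Subtype.ext (by
      have : τ (c : K) = c := c.2
      simp [Subfield.smul_def, this, mul_assoc]))
    (fun x x' y => by simp [hpolar])
    (fun c x y => by
      have : τ (c : K) = c := c.2
      rw [hpolar, hpolar, ← map_smul]
      simp [Subfield.smul_def, this])

theorem coe_hermitianQuadraticForm_apply (invol : ∀ a, τ (τ a) = a) (B : V →ₛₗ[τ] V →ₗ[K] K)
    (isSymm : B.IsSymm) (x : V) : (hermitianQuadraticForm invol B isSymm x : K) = B x x := rfl

theorem polar_hermitianQuadraticForm (invol : ∀ a, τ (τ a) = a) (B : V →ₛₗ[τ] V →ₗ[K] K)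
    (isSymm : B.IsSymm) (x y : V) : QuadraticMap.polar (hermitianQuadraticForm invol B isSymm) x y
      = involutionTrace invol (B x y) := by
  refine Subtype.ext ?_
  simp only [QuadraticMap.polar, involutionTrace, LinearMap.coe_mk, AddHom.coe_mk,
    AddSubgroupClass.coe_sub, coe_hermitianQuadraticForm_apply, map_add, LinearMap.add_apply,
    isSymm.eq]
  ring

end FixedField

/-! ### Spectral bounds in terms of the ovoid number -/

namespace PolarForm

section Energy

variable {K V : Type*} [Field K] [Finite K] [AddCommGroup V] [Module K V] [FiniteDimensional K V]
  [Fintype V]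

theorem exists_addChar_ne_one (k : Type*) [Field k] [Finite k] : ∃ ψ : AddChar k ℂ, ψ ≠ 1 := by
  obtain ⟨ψ, hψ⟩ := AddChar.exists_apply_ne_zero.mpr (one_ne_zero (α := k))
  exact ⟨ψ, fun h => hψ (by simp [h])⟩

theorem energy_nonneg_alternating (B : V →ₗ[K] V →ₗ[K] K) (isAlt : B.IsAlt)
    (nondeg : B.Nondegenerate) {ψ : AddChar K ℂ} (hψ : ψ ≠ 1) (u : V → ℝ)
    (hu : IsScaleInvariant K u) :
    0 ≤ ∑ x, u x * (∑ y, u y * ψ (B x y)).re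
      + (Nat.card K : ℝ) ^ (finrank K V / 2) * ∑ x, u x ^ 2 := by
  set f := alternating B isAlt nondeg with hf
  obtain ⟨W, hW⟩ := f.exists_isGenerator
  -- A generator is its own orthogonal complement, so n is even and the square root of |V| is
  -- q^(n/2).
  have horth : LinearMap.BilinForm.orthogonal B W = W := by
    ext v
    rw [LinearMap.BilinForm.mem_orthogonal_iff]
    constructor
    · intro h
      exact hW.mem_of_perp trivial fun w hw => f.form_comm (h w hw)
    · intro hv w hw
      exact hW.1 w hw v hv
  have h1 := LinearMap.BilinForm.finrank_orthogonal (B := B) nondeg W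
  rw [horth] at h1
  have h2 := W.finrank_le
  refine alternating_energy_nonneg hψ B nondeg _ (by simp [Nat.card_pos]) ?_ u hu
  rw [← Nat.card_eq_fintype_card (α := V), Module.natCard_eq_pow_finrank (K := K) (V := V),
    ← pow_mul, Nat.cast_pow]
  congr 1
  omega

theorem energy_nonneg_quadratic (Q : QuadraticForm K V)
    (nondeg : ∀ v, Q v = 0 → (∀ w, QuadraticMap.polar Q v w = 0) → v = 0)
    (hr : 1 ≤ (quadratic Q nondeg).rank) {ψ : AddChar K ℂ} (hψ : ψ ≠ 1)
    (u : V → ℝ) (hu : IsScaleInvariant K u) (huQ : ∀ x, Q x ≠ 0 → u x = 0) :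
    0 ≤ ∑ x, u x * (∑ y, u y * ψ (QuadraticMap.polar Q x y)).re
      + ((ovoidNumber (quadratic Q nondeg).type (finrank K V) (Nat.card K) : ℝ) - 1)
        * ∑ x, u x ^ 2 := by
  obtain ⟨W, hW⟩ := (quadratic Q nondeg).exists_isGenerator
  have hmax : ∀ v ∈ polarOrth Q W, Q v = 0 → v ∈ W := fun v hv hQv => hW.mem_of_perp hQv hv
  have hdim := finrank_le_two_mul_add_two Q nondeg W hW.1 hmax
  -- The true exponent is n - r - 1. Together with n ≤ 2r + 2, each type bounds it by the exponent
  -- in its ovoid number.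
  have hbound (m : ℕ) (hm : finrank K V ≤ finrank K W + m + 1) :=
    quadratic_energy_bound hψ Q nondeg W hW.1 hmax m hm u hu huQ
  have hWr : finrank K W = (quadratic Q nondeg).rank := hW.2
  rw [hWr] at hdim hbound
  simp only [type]
  split_ifs with h1 h2
  · obtain ⟨j, hj⟩ := h1
    simpa [ovoidNumber] using hbound ((finrank K V - 1) / 2) (by omega)
  · simpa [ovoidNumber] using hbound (finrank K V / 2 - 1) (by omega)
  · rw [Nat.not_odd_iff_even] at h1
    obtain ⟨j, hj⟩ := h1
    simpa [ovoidNumber] using hbound (finrank K V / 2) (by omega)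

theorem energy_nonneg_hermitian (τ : K →+* K) (invol : ∀ a, τ (τ a) = a)
    (ne_id : τ ≠ RingHom.id K) (B : V →ₛₗ[τ] V →ₗ[K] K) (isSymm : B.IsSymm)
    (nondeg : B.Nondegenerate) : ∃ ψ : AddChar K ℂ, ψ ≠ 1 ∧ ∀ u : V → ℝ, IsScaleInvariant K u →
      (∀ x, B x x ≠ 0 → u x = 0) → 0 ≤ ∑ x, u x * (∑ y, u y * ψ (B x y)).re
      + ((ovoidNumber .hermitian (finrank K V) (Nat.card K) : ℝ) - 1) * ∑ x, u x ^ 2 := by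
  set f := hermitian τ invol ne_id B isSymm nondeg with hf
  obtain ⟨χ, hχ⟩ := exists_addChar_ne_one (fixedSubfield τ)
  have hone : involutionTrace invol ≠ 0 := fun h =>
    one_ne_zero (eq_zero_of_involutionTrace invol ne_id (z := 1) fun c => by rw [h]; rfl)
  refine ⟨χ.compAddMonoidHom (involutionTrace invol).toAddMonoidHom, fun h => hχ ?_,
    fun u hu huQ => ?_⟩
  · obtain ⟨z, hz⟩ := DFunLike.ne_iff.mp hone
    ext a
    have := DFunLike.congr_fun h ((a / involutionTrace invol z) • z)
    simpa [div_mul_cancel₀ _ (show involutionTrace invol z ≠ 0 from hz)] using this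
  · set H := hermitianQuadraticForm invol B isSymm with hH
    have hpolar := polar_hermitianQuadraticForm invol B isSymm
    have hH0 (x : V) : H x = 0 ↔ B x x = 0 :=
      ⟨fun h => congrArg Subtype.val h, fun h => Subtype.ext h⟩
    have hB0 {v w : V} (h : ∀ c : K, involutionTrace invol (B v (c • w)) = 0) : B v w = 0 :=
      eq_zero_of_involutionTrace invol ne_id fun c => by simpa using h c
    have hnd : ∀ v, H v = 0 → (∀ w, QuadraticMap.polar H v w = 0) → v = 0 := fun v _ hv =>
      nondeg.1 v fun w => hB0 fun c => by rw [← hpolar]; exact hv _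
    obtain ⟨W, hW⟩ := f.exists_isGenerator
    have hWH : ∀ w ∈ W.restrictScalars (fixedSubfield τ), H w = 0 := fun w hw =>
      (hH0 w).mpr (hW.1 w hw w hw)
    -- Trace-orthogonality to a K-subspace is orthogonality, so a Hermitian generator stays maximal
    -- over the fixed field.
    have hmax : ∀ v ∈ polarOrth H (W.restrictScalars (fixedSubfield τ)), H v = 0 →
        v ∈ W.restrictScalars (fixedSubfield τ) := fun v hv hHv =>
      hW.mem_of_perp ((hH0 v).mp hHv) fun w hw => hB0 fun c => by
        rw [← hpolar]
        exact hv _ (W.smul_mem c hw)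
    have hk := finrank_fixedSubfield invol ne_id
    have hdimV := Module.finrank_mul_finrank (fixedSubfield τ) K V
    have hdimW := finrank_eq_of_eq_restrictScalars (k := fixedSubfield τ) (W := W) rfl
    have hfd : FiniteDimensional (fixedSubfield τ) V := Module.Finite.of_finite
    have hdim := finrank_le_two_mul_add_two H hnd _ hWH hmax
    have hbound (m : ℕ) (hm) :=
      quadratic_energy_bound hχ H hnd _ hWH hmax m hm u
        (fun c x hc => hu (c : K) x (by simpa using hc)) fun x hx => huQ x ((hH0 x).not.mp hx)
    have hsqrt : Nat.sqrt (Nat.card K) = Nat.card (fixedSubfield τ) := by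
      rw [Module.natCard_eq_pow_finrank (K := fixedSubfield τ) (V := K), hk, Nat.sqrt_eq']
    rw [← hdimV, hdimW, hk] at hdim hbound
    simp only [hH, hpolar] at hbound
    simp only [AddChar.compAddMonoidHom_apply, ovoidNumber, hsqrt]
    split_ifs with hodd
    · simpa using hbound (finrank K V) (by omega)
    · rw [Nat.not_odd_iff_even] at hodd
      obtain ⟨j, hj⟩ := hodd
      simpa using hbound (finrank K V - 1) (by omega)

/-- The least eigenvalue of the orthogonality relation on the singular vectors, in terms of the
ovoid number. -/
theorem energy_nonneg (f : PolarForm K V) (hr : 1 ≤ f.rank) :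
    ∃ ψ : AddChar K ℂ, ψ ≠ 1 ∧ ∀ u : V → ℝ, IsScaleInvariant K u →
      (∀ x, ¬ f.IsSingular x → u x = 0) → 0 ≤ ∑ x, u x * (∑ y, u y * ψ (f.form x y)).re
      + ((ovoidNumber f.type (finrank K V) (Nat.card K) : ℝ) - 1) * ∑ x, u x ^ 2 := by
  obtain ⟨ψ, hψ⟩ := exists_addChar_ne_one K
  cases f with
  | alternating B isAlt nondeg =>
    refine ⟨ψ, hψ, fun u hu _ => ?_⟩
    simpa [type, ovoidNumber, form] using energy_nonneg_alternating B isAlt nondeg hψ u hu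
  | hermitian τ invol ne_id B isSymm nondeg =>
    exact energy_nonneg_hermitian τ invol ne_id B isSymm nondeg
  | quadratic Q nondeg =>
    exact ⟨ψ, hψ, fun u hu hus => energy_nonneg_quadratic Q nondeg hr hψ u hu hus⟩

end Energy

/-! ### Counting with the weight function of a point set -/

section Counting

variable {K V : Type*} [Field K] [AddCommGroup V] [Module K V]

theorem sum_eq_add_sum_points [Fintype V] [Fintype Kˣ] [Fintype (ℙ K V)] {M : Type*}
    [AddCommMonoid M] (F : V → M) :
    ∑ x, F x = F 0 + ∑ P : ℙ K V, ∑ c : Kˣ, F ((c : K) • P.rep) := by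
  classical
  rw [Fintype.sum_eq_add_sum_compl 0, ← Fintype.sum_prod_type']
  congr 1
  refine (Finset.sum_bij (fun (p : ℙ K V × Kˣ) _ => (p.2 : K) • p.1.rep) ?_ ?_ ?_ ?_).symm
  · rintro ⟨P, c⟩ -
    simpa using P.rep_nonzero
  · rintro ⟨P, c⟩ - ⟨P', c'⟩ - h
    simp only at h
    have hP : P = P' := eq_of_rep_eq_smul (c := (c⁻¹ : Kˣ) * (c' : K)) (by
      rw [mul_smul, ← h, smul_smul]; simp)
    subst hP
    have := smul_left_injective K P.rep_nonzero h
    exact Prod.ext rfl (Units.ext this)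
  · intro x hx
    have hx0 : x ≠ 0 := by simpa using hx
    obtain ⟨a, ha⟩ := Projectivization.exists_smul_eq_mk_rep K x hx0
    exact ⟨(Projectivization.mk K x hx0, a⁻¹), Finset.mem_univ _, by simp [← ha, Units.smul_def]⟩
  · simp

open Classical in
theorem sum_units_addChar [Fintype K] {ψ : AddChar K ℂ} (hψ : ψ ≠ 1) (b : K) :
    ∑ c : Kˣ, ψ (c * b) = (if b = 0 then (Fintype.card K : ℂ) else 0) - 1 := by
  have h := sum_addChar_mul hψ b
  rw [Fintype.sum_eq_add_sum_compl 0] at h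
  rw [← h, zero_mul, AddChar.map_zero_eq_one, add_sub_cancel_left]
  refine Finset.sum_bij (fun c _ => (c : K)) (by simp) (fun _ _ _ _ h => Units.ext h) ?_ (by simp)
  intro c hc
  exact ⟨Units.mk0 c (by simpa using hc), Finset.mem_univ _, rfl⟩

open Classical in
/-- The function taking the value `1` on the vectors of the points in `O` and `1 - q` at `0`. -/
noncomputable def ovoidWeight (O : Set (ℙ K V)) (x : V) : ℝ :=
  if hx : x = 0 then 1 - Nat.card K else if Projectivization.mk K x hx ∈ O then 1 else 0

theorem ovoidWeight_zero (O : Set (ℙ K V)) : ovoidWeight O 0 = 1 - Nat.card K := by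
  simp [ovoidWeight]

open Classical in
theorem ovoidWeight_smul_rep (O : Set (ℙ K V)) (P : ℙ K V) (c : Kˣ) :
    ovoidWeight O ((c : K) • P.rep) = if P ∈ O then 1 else 0 := by
  have h0 : (c : K) • P.rep ≠ 0 := by simpa using P.rep_nonzero
  have h1 : Projectivization.mk K ((c : K) • P.rep) h0 = P := by
    conv_rhs => rw [← P.mk_rep]
    rw [Projectivization.mk_eq_mk_iff]
    exact ⟨c, rfl⟩
  rw [ovoidWeight, dif_neg h0, h1]

theorem isScaleInvariant_ovoidWeight (O : Set (ℙ K V)) : IsScaleInvariant K (ovoidWeight O) := by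
  classical
  intro c x hc
  by_cases hx : x = 0
  · simp [hx]
  · have h0 : c • x ≠ 0 := smul_ne_zero hc hx
    have h1 : Projectivization.mk K (c • x) h0 = Projectivization.mk K x hx := by
      rw [Projectivization.mk_eq_mk_iff']
      exact ⟨c, rfl⟩
    simp only [ovoidWeight, dif_neg h0, dif_neg hx, h1]

open Classical in
theorem sum_ovoidWeight_smul [Fintype V] [Fintype Kˣ] [Fintype (ℙ K V)] {M : Type*}
    [AddCommGroup M] [Module ℝ M] (O : Set (ℙ K V)) (F : V → M) :
    ∑ x, ovoidWeight O x • F x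
      = (1 - Nat.card K : ℝ) • F 0 + ∑ P ∈ O.toFinset, ∑ c : Kˣ, F ((c : K) • P.rep) := by
  rw [sum_eq_add_sum_points (K := K), ovoidWeight_zero]
  congr 1
  rw [← Finset.sum_filter_add_sum_filter_not Finset.univ (· ∈ O)]
  simp_rw [ovoidWeight_smul_rep]
  rw [Finset.sum_congr rfl fun P hP => Finset.sum_congr rfl fun c _ => by
      rw [if_pos (Finset.mem_filter.mp hP).2, one_smul],
    Finset.sum_eq_zero (s := Finset.univ.filter (¬ · ∈ O)) fun P hP =>
      Finset.sum_eq_zero fun c _ => by rw [if_neg (Finset.mem_filter.mp hP).2, zero_smul], add_zero]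
  congr 1
  ext P
  simp

end Counting

variable {K V : Type*} [Field K] [Finite K] [AddCommGroup V] [Module K V] [FiniteDimensional K V]

/-- A set of points of a polar space, each of which is orthogonal to at most `d` others, has at
most `q * d + σ` elements, where `σ` is the ovoid number. -/
theorem ncard_le_of_perp_le (f : PolarForm K V) (hr : 1 ≤ f.rank) (O : Set (ℙ K V))
    (hO : ∀ P ∈ O, f.IsTotallySingular P.submodule) (d : ℕ)
    (hd : ∀ E ∈ O, {P ∈ O | P ≠ E ∧ f.form E.rep P.rep = 0}.ncard ≤ d) :
    O.ncard ≤ Nat.card K * d + ovoidNumber f.type (finrank K V) (Nat.card K) := by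
  classical
  have := Fintype.ofFinite K
  have : Finite V := Module.finite_of_finite K
  have := Fintype.ofFinite V
  have := Fintype.ofFinite (ℙ K V)
  obtain ⟨ψ, hψ, henergy⟩ := f.energy_nonneg hr
  set σ := ovoidNumber f.type (finrank K V) (Nat.card K)
  set q : ℝ := (Nat.card K : ℝ) with hq
  have hq1 : 1 < q := by rw [hq]; exact_mod_cast Finite.one_lt_card
  set s : ℝ := (O.ncard : ℝ) with hs
  have hsO : (O.toFinset.card : ℝ) = s := by rw [hs, Set.ncard_eq_toFinset_card']
  have hunits : (Fintype.card Kˣ : ℝ) = q - 1 := by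
    rw [Fintype.card_units, hq, Nat.card_eq_fintype_card, Nat.cast_sub Fintype.card_pos]
    simp
  -- The value 1 - q at 0 is the one for which the final inequality becomes an equality when d = 0
  -- and s = σ; the value 0 would give a bound larger by q - 1.
  set u := ovoidWeight O with hu
  have hus (x : V) (hx : ¬ f.IsSingular x) : u x = 0 := by
    have hx0 : x ≠ 0 := fun h => hx (h ▸ f.isSingular_zero)
    rw [hu, ovoidWeight, dif_neg hx0, if_neg]
    intro hm
    have h1 := hO _ hm
    rw [Projectivization.submodule_mk, isTotallySingular_span_iff] at h1
    exact hx h1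
  set N : V → ℝ := fun x => ((O.toFinset.filter fun P => f.form x P.rep = 0).card : ℝ) with hN
  -- The zero vector contributes 1 - q, and each point of `O` contributes q - 1 or -1 according to
  -- whether it is orthogonal to x.
  have hhat (x : V) : (∑ y, u y * ψ (f.form x y)).re = 1 - q + (q * N x - s) := by
    have h1 : ∑ y, u y * ψ (f.form x y) = ((1 - q + (q * N x - s) : ℝ) : ℂ) := by
      have h2 := sum_ovoidWeight_smul O (fun y => ψ (f.form x y))
      simp_rw [Complex.real_smul] at h2
      rw [h2]
      simp only [map_smul, smul_eq_mul, sum_units_addChar hψ, map_zero,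
        AddChar.map_zero_eq_one, mul_one, Finset.sum_sub_distrib, ← Finset.sum_filter,
        Finset.sum_const, nsmul_eq_mul, ← hsO, hN, hq, Nat.card_eq_fintype_card]
      push_cast
      ring
    rw [h1, Complex.ofReal_re]
  have hNsmul (P : ℙ K V) (c : Kˣ) : N ((c : K) • P.rep) = N P.rep := by
    simp only [hN]
    congr 2
    ext P'
    simp only [Finset.mem_filter, and_congr_right_iff]
    refine fun _ => ⟨fun h => ?_, fun h => f.form_smul_left_eq_zero _ h⟩
    have := f.form_smul_left_eq_zero (c⁻¹ : Kˣ) h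
    simpa [smul_smul] using this
  have hN0 : N 0 = s := by
    simp [hN, form_zero_left, hs, Set.ncard_eq_toFinset_card']
  -- The extra 1 accounts for P itself, which `N` counts.
  have hNle (P : ℙ K V) (hP : P ∈ O) : N P.rep ≤ d + 1 := by
    have h1 : (O.toFinset.filter fun P' => f.form P.rep P'.rep = 0) ⊆
        insert P {P' ∈ O | P' ≠ P ∧ f.form P.rep P'.rep = 0}.toFinset := by
      intro P' hP'
      by_cases h : P' = P <;> simp_all
    have h2 := (Finset.card_le_card h1).trans (Finset.card_insert_le _ _)
    rw [← Set.ncard_eq_toFinset_card'] at h2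
    have h3 := h2.trans (Nat.add_le_add_right (hd P hP) 1)
    simp only [hN]
    exact_mod_cast h3
  have hsq : ∑ x, u x ^ 2 = (q - 1) ^ 2 + (q - 1) * s := by
    have h2 := sum_ovoidWeight_smul O (ovoidWeight O)
    simp_rw [smul_eq_mul, ← pow_two] at h2
    rw [hu, h2, ovoidWeight_zero, Finset.sum_congr rfl fun P hP => Finset.sum_congr rfl fun c _ =>
      (ovoidWeight_smul_rep O P c).trans (if_pos (Set.mem_toFinset.mp hP))]
    simp only [Finset.sum_const, Finset.card_univ, nsmul_eq_mul, hunits, hsO, mul_one, ← hq]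
    ring
  have hlin : ∑ x, u x * (∑ y, u y * ψ (f.form x y)).re
      ≤ (1 - q) * (1 - q + (q * s - s)) + (q - 1) * (s * (1 - q + (q * (d + 1) - s))) := by
    have h2 := sum_ovoidWeight_smul O (fun x => 1 - q + (q * N x - s))
    simp_rw [smul_eq_mul, hNsmul, hN0, Finset.sum_const, Finset.card_univ, nsmul_eq_mul, hunits,
      ← Finset.mul_sum] at h2
    simp_rw [hhat]
    rw [h2]
    have h3 : ∑ P ∈ O.toFinset, (1 - q + (q * N P.rep - s))
        ≤ ∑ P ∈ O.toFinset, (1 - q + (q * (d + 1) - s)) := by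
      refine Finset.sum_le_sum fun P hP => ?_
      have := mul_le_mul_of_nonneg_left (hNle P (Set.mem_toFinset.mp hP)) (by linarith : 0 ≤ q)
      linarith
    rw [Finset.sum_const, nsmul_eq_mul, hsO] at h3
    have := mul_le_mul_of_nonneg_left h3 (by linarith : 0 ≤ q - 1)
    linarith
  have hfin := henergy u (isScaleInvariant_ovoidWeight O) hus
  by_contra! hlt
  have hlt' : q * d + σ < s := by rw [hq, hs]; exact_mod_cast hlt
  have hσ : (0 : ℝ) ≤ σ := by positivity
  have hqd : 0 ≤ q * d := by positivity
  rw [hsq] at hfin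
  -- If s > qd + σ, the first summand in the bracket is negative and the second is not positive.
  have key : 0 ≤ (q - 1) * ((q - 1) * (σ - s) + s * (q * d + σ - s)) := by
    refine (hfin.trans (add_le_add_left hlin _)).trans_eq ?_
    ring
  have key' := nonneg_of_mul_nonneg_right key (by linarith)
  have h1 : (q - 1) * (σ - s) < 0 := mul_neg_of_pos_of_neg (by linarith) (by linarith)
  have h2 : s * (q * d + σ - s) ≤ 0 :=
    mul_nonpos_of_nonneg_of_nonpos (by positivity) (by linarith)
  linarith

end PolarForm

theorem theorem4p3 {K V : Type*} [Field K] [Finite K] [AddCommGroup V] [Module K V]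
    [FiniteDimensional K V] (f : PolarForm K V) (hr : 3 ≤ f.rank)
    (O : Set (ℙ K V)) (hO : f.IsPartialOvoid 2 O) :
    O.ncard ≤ Nat.card K * maxPartialOvoid K f.type (finrank K V - 2)
      + ovoidNumber f.type (finrank K V) (Nat.card K) :=
  f.ncard_le_of_perp_le (by omega) O hO.1 _ fun _ hE => hO.ncard_perp_le hE
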